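/- Conventions. Let $X$ be a complex manifold (Hausdorff, second countable, pure-dimensional; connectedness is not needed), $m\ge 0$, and $w\in H^0(X,S^m\Omega^1_X)$ a symmetric differential of degree $m$. - $w$ is *of the 1st kind* if every $x\in X$ has a neighbourhood on which $w=\mu_1\cdots\mu_m$ with closed holomorphic 1-forms $\mu_i$ (a holomorphic closed decomposition of $w$ at $x$). - An *abelian relation* at $x$ of a holomorphic closed decomposition $w=\mu_1\cdots\mu_m$ at $x$ is an $m$-tuple $(f_1,\dots,f_m)$ of germs of meromorphic functions at $x$ with $\sum_i f_i\mu_i=0$ and $df_i\wedge\mu_i=0$ for all $i$. The *abelian rank of $w$ is trivial* if, for all $x$ outside some nowhere dense analytic subset of $X$, $w$ has a holomorphic closed decomposition at $x$ whose only abelian relation at $x$ is $(0,\dots,0)$. - $w$ is *split* if $w=\psi_1\cdots\psi_m$ with meromorphic 1-forms $\psi_i$ on $X$, or if $w=\mu_1\cdots\mu_m$ with $\mu_i\in H^0(X,\Omega^1_X\otimes L_i)$ for holomorphic line bundles $L_i$ on $X$ and an isomorphism $L_1\otimes\cdots\otimes L_m\simeq\mathcal O_X$. - For a complex manifold $Y$,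 write $\Omega^1_{Y,cl}$ for the sheaf of closed holomorphic 1-forms on $Y$, and $\mathbb C$ for the constant local system. A *twisted closed decomposition* of a symmetric differential $v$ of degree $m$ on $Y$ consists of local systems $\mathbb C_{\rho_1},\dots,\mathbb C_{\rho_m}$ of complex vector spaces of rank 1 on $Y$, an isomorphism of local systems $\mathbb C_{\rho_1}\otimes\cdots\otimes\mathbb C_{\rho_m}\simeq\mathbb C$, and twisted closed holomorphic 1-forms $\phi_i\in H^0(Y,\Omega^1_{Y,cl}\otimes\mathbb C_{\rho_i})$ such that $v=\phi_1\cdots\phi_m$ through this isomorphism. **Corollary 1.2.** Let $w\in H^0(X,S^m\Omega^1_X)$ be of the 1st kind with trivial abelian rank. Then there are a complex manifold $X'$ and a finite unramified cover $f:X'\to X$ (a surjective, locally biholomorphic covering map with finite fibres), with $X'$ connected if $X$ is connected, such that $f^*w$ has a twisted closed decomposition on $X'$. If $w$ is split, then $w$ itself has a twisted closed decomposition on $X$, so no cover is needed. -/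

import Mathlib

open scoped Manifold ContDiff Topology

universe u

namespace SymDiff

/-! Complex manifolds of dimension `n` are manifolds of class `ω` (analytic over `ℂ`) modelled on
`ℂⁿ = Fin n → ℂ`. All fields below are total functions of the point; the conditions on them are
imposed near a point or on an open set only. -/

section Basic

variable {n m : ℕ} {X : Type u} [TopologicalSpace X] [ChartedSpace (Fin n → ℂ) X]

/-- A (not yet holomorphic) field of complex linear forms on the holomorphic tangent spaces. -/
abbrev OneForm (n : ℕ) (X : Type u) [TopologicalSpace X] [ChartedSpace (Fin n → ℂ) X] : Type u :=
  ∀ x : X, TangentSpace 𝓘(ℂ, Fin n → ℂ) x →L[ℂ] ℂ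

/-- A (not yet holomorphic, not yet symmetric) field of `m`-linear forms on the tangent spaces. -/
abbrev TensorField (n m : ℕ) (X : Type u) [TopologicalSpace X] [ChartedSpace (Fin n → ℂ) X] :
    Type u :=
  ∀ x : X, ContinuousMultilinearMap ℂ (fun _ : Fin m => TangentSpace 𝓘(ℂ, Fin n → ℂ) x) ℂ

/-- The function `f` is holomorphic in a neighbourhood of `x`. -/
def IsHolomorphicAt (n : ℕ) {X : Type u} [TopologicalSpace X] [ChartedSpace (Fin n → ℂ) X]
    (f : X → ℂ) (x : X) : Prop :=
  ContMDiffAt 𝓘(ℂ, Fin n → ℂ) 𝓘(ℂ) ω f x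

/-- The function `f` is constant in a neighbourhood of `x`. -/
def IsLocallyConstantAt {X : Type u} [TopologicalSpace X] (f : X → ℂ) (x : X) : Prop :=
  ∀ᶠ y in 𝓝 x, f y = f x

/-- The expression of the 1-form `μ` in the preferred chart at `x₀`, that is, the pullback of `μ`
under the inverse of that chart; it is meaningful on the target of the chart. -/
noncomputable def OneForm.coord (μ : OneForm n X) (x₀ : X) (z : Fin n → ℂ) :
    (Fin n → ℂ) →L[ℂ] ℂ :=
  (μ ((chartAt (Fin n → ℂ) x₀).symm z)).comp
    (mfderiv 𝓘(ℂ, Fin n → ℂ) 𝓘(ℂ, Fin n → ℂ) (chartAt (Fin n → ℂ) x₀).symm z)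

/-- The expression of the tensor field `w` in the preferred chart at `x₀`. -/
noncomputable def TensorField.coord (w : TensorField n m X) (x₀ : X) (z : Fin n → ℂ) :
    ContinuousMultilinearMap ℂ (fun _ : Fin m => (Fin n → ℂ)) ℂ :=
  (w ((chartAt (Fin n → ℂ) x₀).symm z)).compContinuousLinearMap
    (fun _ => mfderiv 𝓘(ℂ, Fin n → ℂ) 𝓘(ℂ, Fin n → ℂ) (chartAt (Fin n → ℂ) x₀).symm z)

/-- The 1-form `μ` is holomorphic in a neighbourhood of `x`. -/
def OneForm.IsHolomorphicAt (μ : OneForm n X) (x : X) : Prop :=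
  AnalyticAt ℂ (μ.coord x) (chartAt (Fin n → ℂ) x x)

/-- `dμ = 0` at the point `x`: in coordinates, `dμ (u, v) = (D_u μ) v - (D_v μ) u`. -/
def OneForm.IsClosedAt (μ : OneForm n X) (x : X) : Prop :=
  ∀ u v : Fin n → ℂ,
    fderiv ℂ (μ.coord x) (chartAt (Fin n → ℂ) x x) u v =
      fderiv ℂ (μ.coord x) (chartAt (Fin n → ℂ) x x) v u

/-- `μ` is holomorphic near `x`, and `dμ` vanishes at `x`. A closed holomorphic 1-form on an open
set is one that has this property at all points of the set. -/
def OneForm.IsClosedHolomorphicAt (μ : OneForm n X) (x : X) : Prop :=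
  μ.IsHolomorphicAt x ∧ μ.IsClosedAt x

/-- `w ∈ H⁰(X, SᵐΩ¹)`: a holomorphic field of symmetric `m`-linear forms. -/
def IsSymmetricDifferential (w : TensorField n m X) : Prop :=
  (∀ (x : X) (σ : Equiv.Perm (Fin m)) (v : Fin m → TangentSpace 𝓘(ℂ, Fin n → ℂ) x),
      w x (fun i => v (σ i)) = w x v) ∧
    ∀ x : X, AnalyticAt ℂ (w.coord x) (chartAt (Fin n → ℂ) x x)

/-- The symmetric product `α₁ ⋯ αₘ` of linear forms at a point, as a symmetric `m`-linear form:
`(v₁, …, vₘ) ↦ (1 / m!) ∑_σ ∏ᵢ α_{σ i} (vᵢ)`. On the diagonal it is `v ↦ ∏ᵢ αᵢ (v)`. -/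
noncomputable def symProd {x : X} (α : Fin m → TangentSpace 𝓘(ℂ, Fin n → ℂ) x →L[ℂ] ℂ) :
    ContinuousMultilinearMap ℂ (fun _ : Fin m => TangentSpace 𝓘(ℂ, Fin n → ℂ) x) ℂ :=
  ((m.factorial : ℂ))⁻¹ • ∑ σ : Equiv.Perm (Fin m),
    (ContinuousMultilinearMap.mkPiAlgebra ℂ (Fin m) ℂ).compContinuousLinearMap
      (fun i => α (σ i))

/-- The pullback `f^* w` of a tensor field. -/
noncomputable def TensorField.pullback {X' : Type u} [TopologicalSpace X']
    [ChartedSpace (Fin n → ℂ) X'] (f : X' → X) (w : TensorField n m X) : TensorField n m X' :=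
  fun x => (w (f x)).compContinuousLinearMap
    (fun _ => mfderiv 𝓘(ℂ, Fin n → ℂ) 𝓘(ℂ, Fin n → ℂ) f x)

/-! ### Closed decompositions -/

/-- `w = μ₁ ⋯ μₘ` with closed holomorphic 1-forms `μᵢ` on a neighbourhood of `x`. -/
def IsClosedDecompositionAt (w : TensorField n m X) (μ : Fin m → OneForm n X) (x : X) : Prop :=
  ∃ U : Set X, IsOpen U ∧ x ∈ U ∧ (∀ i, ∀ y ∈ U, (μ i).IsClosedHolomorphicAt y) ∧
    ∀ y ∈ U, w y = symProd (fun i => μ i y)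

/-- `w` is of the 1st kind: it has a holomorphic closed decomposition at every point. -/
def IsFirstKind (w : TensorField n m X) : Prop :=
  ∀ x : X, ∃ μ : Fin m → OneForm n X, IsClosedDecompositionAt w μ x

/-! ### Abelian relations -/

/-- A meromorphic germ at `x`, written as a fraction of holomorphic germs with nonzero
denominator. -/
structure MeromorphicGerm (n : ℕ) {X : Type u} [TopologicalSpace X]
    [ChartedSpace (Fin n → ℂ) X] (x : X) where
  num : X → ℂ
  den : X → ℂ
  num_holomorphic : IsHolomorphicAt n num x
  den_holomorphic : IsHolomorphicAt n den x
  den_ne_zero : ∃ᶠ y in 𝓝 x, den y ≠ 0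

/-- The value of the fraction, meaningful off the zeros of the denominator. -/
noncomputable def MeromorphicGerm.val {x : X} (f : MeromorphicGerm n x) (y : X) : ℂ :=
  f.num y / f.den y

/-- The meromorphic germ is zero. -/
def MeromorphicGerm.IsZero {x : X} (f : MeromorphicGerm n x) : Prop :=
  ∀ᶠ y in 𝓝 x, f.num y = 0

/-- The differential `dh` of a function, as a field of linear forms; it is meaningful where `h` is
holomorphic. -/
noncomputable def differential (n : ℕ) {X : Type u} [TopologicalSpace X]
    [ChartedSpace (Fin n → ℂ) X] (h : X → ℂ) : OneForm n X :=
  fun y => mfderiv 𝓘(ℂ, Fin n → ℂ) 𝓘(ℂ) h y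

/-- `(f₁, …, fₘ)` is an abelian relation at `x` of the decomposition with factors `μ₁, …, μₘ`:
`∑ᵢ fᵢ μᵢ = 0` and `dfᵢ ∧ μᵢ = 0`, as identities of meromorphic germs at `x`. -/
def IsAbelianRelation {x : X} (μ : Fin m → OneForm n X) (f : Fin m → MeromorphicGerm n x) :
    Prop :=
  (∀ᶠ y in 𝓝 x, (∀ i, (f i).den y ≠ 0) → ∑ i, (f i).val y • μ i y = 0) ∧
    ∀ i, ∀ᶠ y in 𝓝 x, (f i).den y ≠ 0 →
      ∀ u v : TangentSpace 𝓘(ℂ, Fin n → ℂ) y,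
        differential n (f i).val y u * μ i y v - differential n (f i).val y v * μ i y u = 0

/-- The space of abelian relations at `x` of the decomposition with factors `μ₁, …, μₘ` is
zero. -/
def HasOnlyTrivialAbelianRelations (μ : Fin m → OneForm n X) (x : X) : Prop :=
  ∀ f : Fin m → MeromorphicGerm n x, IsAbelianRelation μ f → ∀ i, (f i).IsZero

/-- `R` is an analytic subset of `X`: near every point of `X` it is the set of common zeros of
finitely many holomorphic functions. -/
def IsAnalyticSubset (n : ℕ) {X : Type u} [TopologicalSpace X] [ChartedSpace (Fin n → ℂ) X]
    (R : Set X) : Prop :=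
  ∀ x : X, ∃ U : Set X, IsOpen U ∧ x ∈ U ∧ ∃ (k : ℕ) (g : Fin k → X → ℂ),
    (∀ i, ∀ y ∈ U, IsHolomorphicAt n (g i) y) ∧ ∀ y ∈ U, y ∈ R ↔ ∀ i, g i y = 0

/-- The abelian rank of `w` is zero: at the general point `x`, that is, for all `x` off a nowhere
dense analytic subset, `w` has a holomorphic closed decomposition at `x` all of whose abelian
relations are zero. (The abelian rank at a general point does not depend on the decomposition.) -/
def HasTrivialAbelianRank (w : TensorField n m X) : Prop :=
  ∃ R : Set X, IsAnalyticSubset n R ∧ interior R = ∅ ∧ ∀ x, x ∉ R →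
    ∃ μ : Fin m → OneForm n X, IsClosedDecompositionAt w μ x ∧
      HasOnlyTrivialAbelianRelations μ x

/-! ### Line bundles, local systems, and forms with values in them -/

/-- A rank 1 object given by a 1-cocycle on the cover `U`, with local frames `e_a` over `U a` and
`e_b = g a b • e_a` over `U a ∩ U b`; the transition functions are nowhere zero and of class `P`.
For `P` holomorphic this is a holomorphic line bundle, for `P` locally constant it is a local system
of 1-dimensional complex vector spaces. -/
structure RankOneCocycle {X : Type u} (P : (X → ℂ) → X → Prop) {ι : Type u} (U : ι → Set X) where
  g : ι → ι → X → ℂ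
  ne_zero : ∀ a b, ∀ x ∈ U a ∩ U b, g a b x ≠ 0
  regular : ∀ a b, ∀ x ∈ U a ∩ U b, P (g a b) x
  cocycle : ∀ a b c, ∀ x ∈ U a ∩ U b ∩ U c, g a b x * g b c x = g a c x

/-- A holomorphic line bundle that is trivialized over the members of the cover `U`. -/
abbrev LineBundle (n : ℕ) {X : Type u} [TopologicalSpace X] [ChartedSpace (Fin n → ℂ) X]
    {ι : Type u} (U : ι → Set X) : Type u :=
  RankOneCocycle (IsHolomorphicAt n (X := X)) U

/-- A local system of rank 1 that is trivialized over the members of the cover `U`. -/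
abbrev RankOneLocalSystem {X : Type u} [TopologicalSpace X] {ι : Type u} (U : ι → Set X) : Type u :=
  RankOneCocycle (IsLocallyConstantAt (X := X)) U

/-- `φ = (φ_a)` is a 1-form with values in `L`: it equals `φ_a ⊗ e_a` over `U a`, the `φ_a` have the
property `Q` at the points of `U a`, and they fit together, `φ_a = g a b • φ_b`. -/
def IsTwistedOneForm {P : (X → ℂ) → X → Prop} {ι : Type u} {U : ι → Set X}
    (Q : OneForm n X → X → Prop) (L : RankOneCocycle P U) (φ : ι → OneForm n X) : Prop :=
  (∀ a, ∀ x ∈ U a, Q (φ a) x) ∧ ∀ a b, ∀ x ∈ U a ∩ U b, φ a x = L.g a b x • φ b x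

/-- `t = (t_a)` is an isomorphism (of line bundles or of local systems, according to `P`) from
`L₁ ⊗ ⋯ ⊗ Lₘ` to the trivial object, mapping the frame `e_{1,a} ⊗ ⋯ ⊗ e_{m,a}` over `U a` to the
nowhere zero function `t_a` of class `P`. -/
def IsTensorTrivialization {X : Type u} {P : (X → ℂ) → X → Prop} {ι : Type u} {U : ι → Set X}
    (L : Fin m → RankOneCocycle P U) (t : ι → X → ℂ) : Prop :=
  (∀ a, ∀ x ∈ U a, t a x ≠ 0 ∧ P (t a) x) ∧
    ∀ a b, ∀ x ∈ U a ∩ U b, t b x = (∏ k, (L k).g a b x) * t a x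

/-- `w = φ₁ ⋯ φₘ`, where the product, a section of `SᵐΩ¹ ⊗ (L₁ ⊗ ⋯ ⊗ Lₘ)`, is regarded as a section
of `SᵐΩ¹` through the isomorphism `t` from `L₁ ⊗ ⋯ ⊗ Lₘ` to the trivial object. -/
def IsTwistedProduct {ι : Type u} (U : ι → Set X) (w : TensorField n m X)
    (φ : Fin m → ι → OneForm n X) (t : ι → X → ℂ) : Prop :=
  ∀ a, ∀ x ∈ U a, w x = t a x • symProd (fun k => φ k a x)

/-- `U` is an open cover of `X`. -/
def IsOpenCover {X : Type u} [TopologicalSpace X] {ι : Type u} (U : ι → Set X) : Prop :=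
  (∀ a, IsOpen (U a)) ∧ ∀ x, ∃ a, x ∈ U a

/-- `w = φ₁ ⋯ φₘ` with closed holomorphic 1-forms `φₖ ∈ H⁰(X, Ω¹_cl ⊗ Lₖ)` twisted by local systems
`Lₖ` of rank 1 such that `L₁ ⊗ ⋯ ⊗ Lₘ ≃ ℂ`. (Finitely many local systems are always trivialized over
a common open cover.) -/
def HasTwistedClosedDecomposition (w : TensorField n m X) : Prop :=
  ∃ (ι : Type u) (U : ι → Set X), IsOpenCover U ∧
    ∃ (L : Fin m → RankOneLocalSystem U) (φ : Fin m → ι → OneForm n X) (t : ι → X → ℂ),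
      (∀ k, IsTwistedOneForm OneForm.IsClosedHolomorphicAt (L k) (φ k)) ∧
        IsTensorTrivialization L t ∧ IsTwistedProduct U w φ t

/-! ### Split symmetric differentials -/

/-- The 1-form `ψ`, whose values at its poles are irrelevant, is meromorphic near `x`: it is the
quotient of a holomorphic 1-form by a nonzero holomorphic function. -/
def OneForm.IsMeromorphicAt (ψ : OneForm n X) (x : X) : Prop :=
  ∃ (α : OneForm n X) (b : X → ℂ), α.IsHolomorphicAt x ∧ SymDiff.IsHolomorphicAt n b x ∧
    (∃ᶠ y in 𝓝 x, b y ≠ 0) ∧ ∀ᶠ y in 𝓝 x, b y ≠ 0 → ψ y = (b y)⁻¹ • α y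

/-- `w = ψ₁ ⋯ ψₘ` with meromorphic 1-forms `ψₖ` on `X`. -/
def IsMeromorphicallySplit (w : TensorField n m X) : Prop :=
  ∃ ψ : Fin m → OneForm n X, (∀ k x, (ψ k).IsMeromorphicAt x) ∧
    ∃ D : Set X, IsOpen D ∧ Dense D ∧ ∀ x ∈ D, w x = symProd (fun k => ψ k x)

/-- `w = μ₁ ⋯ μₘ` with `μₖ ∈ H⁰(X, Ω¹ ⊗ Lₖ)` for holomorphic line bundles `Lₖ`, whose tensor product
is trivialized so that the product of the `μₖ` is a section of `SᵐΩ¹`. -/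
def IsLineBundleSplit (w : TensorField n m X) : Prop :=
  ∃ (ι : Type u) (U : ι → Set X), IsOpenCover U ∧
    ∃ (L : Fin m → LineBundle n U) (μ : Fin m → ι → OneForm n X) (t : ι → X → ℂ),
      (∀ k, IsTwistedOneForm OneForm.IsHolomorphicAt (L k) (μ k)) ∧
        IsTensorTrivialization L t ∧ IsTwistedProduct U w μ t

/-- `w` is split, in either of the two usual senses. -/
def IsSplit (w : TensorField n m X) : Prop :=
  IsMeromorphicallySplit w ∨ IsLineBundleSplit w

/-- `f : X' → X` is a finite unramified cover of complex manifolds: a surjective covering map with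
finite fibres that is locally biholomorphic. -/
def IsFiniteUnramifiedCover (n : ℕ) {X' X : Type u} [TopologicalSpace X']
    [ChartedSpace (Fin n → ℂ) X'] [TopologicalSpace X] [ChartedSpace (Fin n → ℂ) X]
    (f : X' → X) : Prop :=
  IsCoveringMap f ∧ Function.Surjective f ∧ (∀ x, (f ⁻¹' {x}).Finite) ∧
    IsLocalDiffeomorph 𝓘(ℂ, Fin n → ℂ) 𝓘(ℂ, Fin n → ℂ) ω f

end Basic

end SymDiff

/-!
Let `w = ∏ aᵢ = ∏ bᵢ` be two closed decompositions near a point. The kernel of each `bᵢ` lies in the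
union of the kernels of the `aⱼ`, hence in one of them, since finitely many proper subspaces do not
cover a vector space. So the factors are parallel up to order, `aᵢ = gᵢ bᵢ` with `∏ gᵢ = 1`.
Closedness of `aᵢ` and `bᵢ` makes `dgᵢ / gᵢ` a multiple `fᵢ bᵢ` of `bᵢ`, and `∑ dgᵢ / gᵢ = 0` says
that `(fᵢ)` is an abelian relation. Hence it vanishes where the abelian rank is trivial, so the `gᵢ`
are constant there and, by the identity theorem, everywhere: the factors of `w` are unique up to
order and constants. The orderings of the factors therefore form a finite covering of `X`; over a
connected component of it (or on `X` itself, where a splitting of `w` labels the factors) the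
factors are ordered globally, and the constants comparing the local choices are the cocycles of the
local systems.
-/

namespace SymDiff

/-! ### Products of linear forms -/

section LinearForms

variable {𝕜 V ι : Type*} [NontriviallyNormedField 𝕜] [AddCommGroup V] [Module 𝕜 V]
  [TopologicalSpace V]

/-- `α ∧ β = 0` for the linear forms `α` and `β`, that is, one of them is a multiple of the
other. -/
def Parallel (α β : V →L[𝕜] 𝕜) : Prop :=
  ∀ u v, α u * β v = α v * β u

theorem Parallel.symm {α β : V →L[𝕜] 𝕜} (h : Parallel α β) : Parallel β α := fun u v => by
  linear_combination -h u v

theorem Parallel.refl (α : V →L[𝕜] 𝕜) : Parallel α α := fun _ _ => mul_comm _ _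

theorem parallel_zero_left (β : V →L[𝕜] 𝕜) : Parallel 0 β := fun _ _ => by
  simp only [zero_apply, zero_mul]

theorem Parallel.smul_left {α β : V →L[𝕜] 𝕜} (h : Parallel α β) (c : 𝕜) :
    Parallel (c • α) β := fun u v => by
  simp only [smul_apply, smul_eq_mul]
  linear_combination c * h u v

theorem Parallel.eq_smul {α β : V →L[𝕜] 𝕜} (h : Parallel α β) {v : V} (hv : β v ≠ 0) :
    α = (α v / β v) • β := by
  ext u
  rw [smul_apply, smul_eq_mul, div_mul_eq_mul_div, eq_div_iff hv, h u v]

theorem Parallel.trans {α β γ : V →L[𝕜] 𝕜} (h : Parallel α β) (h' : Parallel β γ) (hβ : β ≠ 0) :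
    Parallel α γ := by
  obtain ⟨v, hv⟩ := DFunLike.ne_iff.mp hβ
  rw [h.eq_smul hv]
  exact h'.smul_left _

theorem parallel_of_ker_le {α β : V →L[𝕜] 𝕜} (h : ∀ v, β v = 0 → α v = 0) : Parallel α β := by
  intro u v
  have hα := h (β v • u - β u • v) (by simp only [map_sub, map_smul, smul_eq_mul]; ring)
  simp only [map_sub, map_smul, smul_eq_mul] at hα
  linear_combination hα

theorem exists_forall_apply_ne_zero [Finite ι] {α : ι → V →L[𝕜] 𝕜} (h : ∀ i, α i ≠ 0) :
    ∃ v, ∀ i, α i v ≠ 0 :=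
  Module.Dual.exists_forall_ne_zero_of_forall_exists (fun i => (α i : V →ₗ[𝕜] 𝕜))
    fun i => DFunLike.ne_iff.mp (h i)

variable [Fintype ι] {α β : ι → V →L[𝕜] 𝕜} {c : 𝕜}

theorem ne_zero_of_prod_eq (h : ∀ v, ∏ i, α i v = c * ∏ i, β i v) (hα : ∀ i, α i ≠ 0) :
    c ≠ 0 ∧ ∀ i, β i ≠ 0 := by
  obtain ⟨v, hv⟩ := exists_forall_apply_ne_zero hα
  have hprod : ∏ i, α i v ≠ 0 := Finset.prod_ne_zero_iff.mpr fun i _ => hv i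
  rw [h v, mul_ne_zero_iff, Finset.prod_ne_zero_iff] at hprod
  exact ⟨hprod.1, fun i => DFunLike.ne_iff.mpr ⟨v, hprod.2 i (Finset.mem_univ i)⟩⟩

theorem exists_parallel_of_prod_eq (h : ∀ v, ∏ i, α i v = c * ∏ i, β i v) (i : ι) :
    ∃ j, Parallel (α j) (β i) := by
  by_contra! hnot
  have hker : ∀ j, ∃ v ∈ LinearMap.ker (β i : V →ₗ[𝕜] 𝕜), (α j : V →ₗ[𝕜] 𝕜) v ≠ 0 := by
    intro j
    by_contra! hj
    exact hnot j (parallel_of_ker_le hj)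
  obtain ⟨v, hv, hαv⟩ := Module.Dual.exists_forall_mem_ne_zero_of_forall_exists _ _ hker
  refine Finset.prod_ne_zero_iff.mpr (fun j _ => hαv j) ((h v).trans ?_)
  rw [Finset.prod_eq_zero (Finset.mem_univ i) (LinearMap.mem_ker.mp hv), mul_zero]

theorem exists_perm_parallel_of_prod_eq (h : ∀ v, ∏ i, α i v = c * ∏ i, β i v)
    (hα : ∀ i, α i ≠ 0) (hp : ∀ i j, i ≠ j → ¬ Parallel (α i) (α j)) :
    ∃ τ : Equiv.Perm ι, ∀ i, Parallel (α (τ i)) (β i) := by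
  obtain ⟨hc, hβ⟩ := ne_zero_of_prod_eq h hα
  have h' : ∀ v, ∏ i, β i v = c⁻¹ * ∏ i, α i v := fun v => by
    rw [h v, inv_mul_cancel_left₀ hc]
  choose σ hσ using exists_parallel_of_prod_eq h
  choose ρ hρ using exists_parallel_of_prod_eq h'
  have hsurj : Function.Surjective σ := fun i =>
    ⟨ρ i, by_contra fun hne => hp _ _ hne ((hσ (ρ i)).trans (hρ i) (hβ _))⟩
  exact ⟨Equiv.ofBijective σ (Finite.injective_iff_surjective.mpr hsurj |>.bijective_of_finite), hσ⟩

theorem pairwise_not_parallel_of_prod_eq (h : ∀ v, ∏ i, α i v = c * ∏ i, β i v)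
    (hα : ∀ i, α i ≠ 0) (hp : ∀ i j, i ≠ j → ¬ Parallel (α i) (α j)) :
    ∀ i j, i ≠ j → ¬ Parallel (β i) (β j) := by
  obtain ⟨-, hβ⟩ := ne_zero_of_prod_eq h hα
  obtain ⟨τ, hτ⟩ := exists_perm_parallel_of_prod_eq h hα hp
  intro i j hij hpar
  exact hp _ _ (τ.injective.ne hij) (((hτ i).trans hpar (hβ i)).trans (hτ j).symm (hβ j))

end LinearForms

section SymProd

variable {n m : ℕ} {X : Type u} [TopologicalSpace X] [ChartedSpace (Fin n → ℂ) X]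

theorem symProd_diag {x : X} (α : Fin m → TangentSpace 𝓘(ℂ, Fin n → ℂ) x →L[ℂ] ℂ)
    (v : TangentSpace 𝓘(ℂ, Fin n → ℂ) x) :
    symProd α (fun _ => v) = ∏ i, α i v := by
  have hperm : ∀ σ : Equiv.Perm (Fin m), ∏ i, α (σ i) v = ∏ i, α i v := fun σ =>
    Equiv.prod_comp σ (fun i => α i v)
  simp only [symProd, smul_apply, sum_apply,
    ContinuousMultilinearMap.compContinuousLinearMap_apply,
    ContinuousMultilinearMap.mkPiAlgebra_apply, hperm]
  simp [Fintype.card_perm, Nat.factorial_ne_zero]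

theorem symProd_comp_perm {x : X} (α : Fin m → TangentSpace 𝓘(ℂ, Fin n → ℂ) x →L[ℂ] ℂ)
    (τ : Equiv.Perm (Fin m)) : symProd (fun i => α (τ i)) = symProd α := by
  unfold symProd
  congr 1
  exact Fintype.sum_equiv (Equiv.mulLeft τ) _ _ fun σ => rfl

end SymProd

/-! ### Generic points and the identity theorem -/

section Generically

variable {X Y : Type*} [TopologicalSpace X] [TopologicalSpace Y]

/-- The filter of the sets whose interior is dense in a neighbourhood of `x`. A property that holds
eventually along this filter holds at the general point near `x`. -/
def generically (x : X) : Filter X where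
  sets := {S | ∀ᶠ y in 𝓝 x, y ∈ closure (interior S)}
  univ_sets := by simp
  sets_of_superset {S T} hS hST :=
    hS.mono fun y hy => closure_mono (interior_mono hST) hy
  inter_sets {S T} hS hT := by
    filter_upwards [hS, eventually_eventually_nhds.mpr hT] with y hyS hyT
    rw [interior_inter, mem_closure_iff_frequently, ← frequently_frequently_nhds]
    refine ((mem_closure_iff_frequently.mp hyS).and_eventually hyT).mono fun z hz => ?_
    exact ((mem_closure_iff_frequently.mp hz.2).and_eventually
      (isOpen_interior.mem_nhds hz.1)).mono fun p hp => hp.symm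

theorem generically_le_nhds (x : X) : generically x ≤ 𝓝 x := fun _ hS =>
  (eventually_eventually_nhds.mpr hS).mono fun _ hy =>
    subset_closure (mem_interior_iff_mem_nhds.mpr hy)

instance generically_neBot (x : X) : (generically x).NeBot := by
  refine Filter.neBot_iff.mpr fun hbot => ?_
  have hempty : ∀ᶠ y in 𝓝 x, y ∈ closure (interior (∅ : Set X)) :=
    (hbot ▸ Filter.mem_bot : ∅ ∈ generically x)
  simpa using hempty.self_of_nhds

theorem eventually_eventually_generically {x : X} {P : X → Prop}
    (h : ∀ᶠ y in generically x, P y) : ∀ᶠ y in 𝓝 x, ∀ᶠ z in generically y, P z :=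
  eventually_eventually_nhds.mpr h

theorem eventually_generically_mem_of_dense {D : Set X} (hD : IsOpen D) (hd : Dense D) (x : X) :
    ∀ᶠ y in generically x, y ∈ D := by
  change ∀ᶠ y in 𝓝 x, y ∈ closure (interior D)
  rw [hD.interior_eq]
  exact Filter.Eventually.of_forall hd

theorem exists_mem_of_eventually_generically {s : Set X} (hs : Dense s) {x : X} {P : X → Prop}
    (h : ∀ᶠ y in generically x, P y) : ∃ y ∈ s, P y := by
  have hx : x ∈ closure (interior {y | P y}) := (show ∀ᶠ y in 𝓝 x, _ from h).self_of_nhds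
  obtain ⟨y, hyP, hys⟩ := hs.inter_open_nonempty _ isOpen_interior (closure_nonempty_iff.mp ⟨x, hx⟩)
  exact ⟨y, hys, interior_subset hyP⟩

theorem tendsto_generically (φ : OpenPartialHomeomorph X Y) {x : X} (hx : x ∈ φ.source) :
    Filter.Tendsto φ (generically x) (generically (φ x)) := by
  intro S hS
  change ∀ᶠ y in 𝓝 x, y ∈ closure (interior (φ ⁻¹' S))
  filter_upwards [(φ.continuousAt hx).eventually hS, φ.open_source.mem_nhds hx] with y hyS hy
  rw [mem_closure_iff_frequently, ← φ.map_nhds_eq hy, Filter.frequently_map] at hyS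
  refine mem_closure_iff_frequently.mpr
    ((hyS.and_eventually (φ.open_source.mem_nhds hy)).mono fun z hz => ?_)
  exact mem_interior_iff_mem_nhds.mpr
    ((φ.continuousAt hz.2).preimage_mem_nhds (mem_interior_iff_mem_nhds.mp hz.1))

end Generically

section IdentityTheorem

theorem analyticAt_smulRight {𝕜 W V E : Type*} [NontriviallyNormedField 𝕜]
    [NormedAddCommGroup W] [NormedSpace 𝕜 W] [NormedAddCommGroup V] [NormedSpace 𝕜 V]
    [NormedAddCommGroup E] [NormedSpace 𝕜 E] {a : W → V →L[𝕜] 𝕜} {F : W → E} {p : W}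
    (ha : AnalyticAt 𝕜 a p) (hF : AnalyticAt 𝕜 F p) :
    AnalyticAt 𝕜 (fun z => (a z).smulRight (F z)) p :=
  ((ContinuousLinearMap.smulRightL 𝕜 V E).analyticAt_bilinear (a p, F p)).comp₂ ha hF

variable {𝕜 W E : Type*} [NontriviallyNormedField 𝕜] [IsRCLikeNormedField 𝕜]
  [NormedAddCommGroup W] [NormedSpace 𝕜 W] [NormedAddCommGroup E] [NormedSpace 𝕜 E]
  {F G : W → E} {p : W}

theorem eventually_eq_const_of_fderiv_eq_zero
    (hF : ∀ᶠ z in 𝓝 p, DifferentiableAt 𝕜 F z) (hF' : ∀ᶠ z in 𝓝 p, fderiv 𝕜 F z = 0) :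
    ∀ᶠ z in 𝓝 p, F z = F p := by
  let _ := IsRCLikeNormedField.rclike 𝕜
  let _ := NormedSpace.restrictScalars ℝ 𝕜 W
  obtain ⟨r, hr, hball⟩ := Metric.eventually_nhds_iff_ball.mp (hF.and hF')
  filter_upwards [Metric.ball_mem_nhds p hr] with z hz
  exact Metric.isOpen_ball.is_const_of_fderiv_eq_zero Metric.isPreconnected_ball
    (fun y hy => (hball y hy).1.differentiableWithinAt) (fun y hy => (hball y hy).2) hz
    (Metric.mem_ball_self hr)

variable [CompleteSpace E]

theorem eventually_forall_eq_smul_imp (hF : AnalyticAt 𝕜 F p) (hG : AnalyticAt 𝕜 G p) :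
    ∀ᶠ q in 𝓝 p, ∀ c : 𝕜, (∀ᶠ z in 𝓝 q, F z = c • G z) → ∀ᶠ z in 𝓝 p, F z = c • G z := by
  let _ := IsRCLikeNormedField.rclike 𝕜
  let _ := NormedSpace.restrictScalars ℝ 𝕜 W
  obtain ⟨r, hr, hball⟩ := Metric.eventually_nhds_iff_ball.mp
    (hF.eventually_analyticAt.and hG.eventually_analyticAt)
  filter_upwards [Metric.ball_mem_nhds p hr] with q hq c hc
  have hdiff : AnalyticOnNhd 𝕜 (fun z => F z - c • G z) (Metric.ball p r) :=
    fun z hz => (hball z hz).1.sub ((hball z hz).2.const_smul (c := c))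
  have hzero := hdiff.eqOn_zero_of_preconnected_of_eventuallyEq_zero
    Metric.isPreconnected_ball hq (hc.mono fun z hz => sub_eq_zero.mpr hz)
  filter_upwards [Metric.ball_mem_nhds p hr] with z hz using sub_eq_zero.mp (hzero hz)

theorem eventually_eq_zero_or_generically_ne_zero (hF : AnalyticAt 𝕜 F p) :
    (∀ᶠ z in 𝓝 p, F z = 0) ∨ ∀ᶠ z in generically p, F z ≠ 0 := by
  refine or_iff_not_imp_left.mpr fun hnot => ?_
  change ∀ᶠ q in 𝓝 p, q ∈ closure (interior {z | F z ≠ 0})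
  filter_upwards [eventually_forall_eq_smul_imp hF hF,
    eventually_eventually_nhds.mpr hF.eventually_analyticAt] with q hq hFq
  have hfreq : ∃ᶠ z in 𝓝 q, F z ≠ 0 := fun hz =>
    hnot (by simpa only [zero_smul] using hq 0 (hz.mono fun z hz => by simpa using hz))
  refine mem_closure_iff_frequently.mpr ((hfreq.and_eventually hFq).mono fun z hz => ?_)
  exact mem_interior_iff_mem_nhds.mpr (hz.2.continuousAt.eventually_ne hz.1)

theorem eventually_parallel_or_generically_not_parallel [CompleteSpace 𝕜] {a b : W → W →L[𝕜] 𝕜}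
    (ha : AnalyticAt 𝕜 a p) (hb : AnalyticAt 𝕜 b p) :
    (∀ᶠ z in 𝓝 p, Parallel (a z) (b z)) ∨ ∀ᶠ z in generically p, ¬ Parallel (a z) (b z) := by
  have hwedge : ∀ z, (a z).smulRight (b z) - (b z).smulRight (a z) = 0 ↔
      Parallel (a z) (b z) := fun z => by
    refine (sub_eq_zero (G := W →L[𝕜] W →L[𝕜] 𝕜)).trans ?_
    simp only [ContinuousLinearMap.ext_iff, Parallel, ContinuousLinearMap.smulRight_apply,
      smul_apply, smul_eq_mul, mul_comm (b z _)]
  have han : AnalyticAt 𝕜 (fun z => (a z).smulRight (b z) - (b z).smulRight (a z)) p :=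
    (analyticAt_smulRight ha hb).sub (analyticAt_smulRight hb ha)
  simpa only [ne_eq, hwedge] using eventually_eq_zero_or_generically_ne_zero han

end IdentityTheorem

/-! ### Closed forms on a normed space -/

section ClosedForms

variable {𝕜 W ι : Type*} [NontriviallyNormedField 𝕜] [NormedAddCommGroup W] [NormedSpace 𝕜 W]

/-- The 1-form `a` on `W` satisfies `da = 0` near `p`. -/
def ClosedNear (a : W → W →L[𝕜] 𝕜) (p : W) : Prop :=
  ∀ᶠ z in 𝓝 p, ∀ u v, fderiv 𝕜 a z u v = fderiv 𝕜 a z v u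

/-- The 1-forms `b i` on `W` have no nonzero analytic abelian relation at `p`, that is, no analytic
functions `f i`, not all zero near `p`, with `∑ f i • b i = 0` and `d(f i) ∧ b i = 0`. -/
def HasNoAnalyticRelation [Fintype ι] (b : ι → W → W →L[𝕜] 𝕜) (p : W) : Prop :=
  ∀ f : ι → W → 𝕜, (∀ i, AnalyticAt 𝕜 (f i) p) →
    (∀ᶠ z in 𝓝 p, ∑ i, f i z • b i z = 0) →
    (∀ i, ∀ᶠ z in 𝓝 p, Parallel (fderiv 𝕜 (f i) z) (b i z)) →
    ∀ i, ∀ᶠ z in 𝓝 p, f i z = 0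

theorem exists_analyticAt_smul_of_parallel {a b : W → W →L[𝕜] 𝕜} {p : W}
    (ha : AnalyticAt 𝕜 a p) (hb : AnalyticAt 𝕜 b p) (hb0 : b p ≠ 0)
    (hpar : ∀ᶠ z in 𝓝 p, Parallel (a z) (b z)) :
    ∃ g : W → 𝕜, AnalyticAt 𝕜 g p ∧ ∀ᶠ z in 𝓝 p, a z = g z • b z := by
  obtain ⟨v, hv⟩ := DFunLike.ne_iff.mp hb0
  have hav : AnalyticAt 𝕜 (fun z => a z v) p :=
    ((ContinuousLinearMap.apply 𝕜 𝕜 v).analyticAt _).comp ha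
  have hbv : AnalyticAt 𝕜 (fun z => b z v) p :=
    ((ContinuousLinearMap.apply 𝕜 𝕜 v).analyticAt _).comp hb
  refine ⟨fun z => a z v / b z v, hav.div hbv hv, ?_⟩
  filter_upwards [hbv.continuousAt.eventually_ne hv, hpar] with z hz hpar using hpar.eq_smul hz

theorem sum_inv_smul_fderiv_eq_zero [Fintype ι] {g : ι → W → 𝕜} {p : W}
    (hg : ∀ i, DifferentiableAt 𝕜 (g i) p) (hprod : ∀ᶠ z in 𝓝 p, ∏ i, g i z = 1) :
    ∑ i, (g i p)⁻¹ • fderiv 𝕜 (g i) p = 0 := by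
  classical
  have hconst : (fun z => ∏ i, g i z) =ᶠ[𝓝 p] fun _ => 1 := hprod
  have hderiv := (HasFDerivAt.finsetProd fun i (_ : i ∈ Finset.univ) => (hg i).hasFDerivAt).fderiv
  rw [hconst.fderiv_eq, fderiv_const_apply] at hderiv
  rw [hderiv]
  refine Finset.sum_congr rfl fun i _ => ?_
  have hi := Finset.mul_prod_erase Finset.univ (fun i => g i p) (Finset.mem_univ i)
  rw [eq_inv_of_mul_eq_one_right (hi.trans hprod.self_of_nhds)]

theorem HasNoAnalyticRelation.not_eventually_eq_zero [Fintype ι] {b : ι → W → W →L[𝕜] 𝕜} {p : W}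
    (hrel : HasNoAnalyticRelation b p) (i : ι) :
    ¬ ∀ᶠ z in 𝓝 p, b i z = 0 := by
  classical
  intro hzero
  have hf := hrel (fun k _ => (Pi.single i 1 : ι → 𝕜) k) (fun _ => analyticAt_const) ?_
    (fun k => Filter.Eventually.of_forall fun z => by
      rw [fderiv_const_apply]; exact parallel_zero_left _) i
  · simpa using hf.self_of_nhds
  · filter_upwards [hzero] with z hz
    rw [Fintype.sum_eq_single i fun k hk => by rw [Pi.single_eq_of_ne hk, zero_smul 𝕜 (b k z)],
      Pi.single_eq_same, one_smul, hz]

theorem fderiv_pullback_symm {W' : Type*} [NormedAddCommGroup W'] [NormedSpace 𝕜 W']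
    [CompleteSpace W] {a : W → W →L[𝕜] 𝕜} {τ : W' → W} {z : W'}
    (hτ : AnalyticAt 𝕜 τ z) (ha : DifferentiableAt 𝕜 a (τ z))
    (hac : ∀ u v, fderiv 𝕜 a (τ z) u v = fderiv 𝕜 a (τ z) v u) (u v : W') :
    fderiv 𝕜 (fun y => (a (τ y)).comp (fderiv 𝕜 τ y)) z u v =
      fderiv 𝕜 (fun y => (a (τ y)).comp (fderiv 𝕜 τ y)) z v u := by
  have hsymm : IsSymmSndFDerivAt 𝕜 τ z := hτ.contDiffAt.isSymmSndFDerivAt (n := ω) le_top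
  have hcomp : HasFDerivAt (fun y => a (τ y)) ((fderiv 𝕜 a (τ z)).comp (fderiv 𝕜 τ z)) z :=
    ha.hasFDerivAt.comp z hτ.differentiableAt.hasFDerivAt
  rw [(hcomp.clm_comp hτ.fderiv.differentiableAt.hasFDerivAt).fderiv]
  simp [hac (fderiv 𝕜 τ z u), hsymm u v]

variable [CompleteSpace 𝕜]

theorem eventually_parallel_fderiv_of_eq_smul {a b : W → W →L[𝕜] 𝕜} {g : W → 𝕜} {p : W}
    (hg : AnalyticAt 𝕜 g p) (hb : AnalyticAt 𝕜 b p) (hab : ∀ᶠ z in 𝓝 p, a z = g z • b z)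
    (hac : ClosedNear a p) (hbc : ClosedNear b p) :
    ∀ᶠ z in 𝓝 p, Parallel (fderiv 𝕜 g z) (b z) := by
  filter_upwards [eventually_eventually_nhds.mpr hab, hg.eventually_analyticAt,
    hb.eventually_analyticAt, hac, hbc] with z hab hg hb ha' hb' u v
  have hda : fderiv 𝕜 a z = fderiv 𝕜 (fun y => g y • b y) z := Filter.EventuallyEq.fderiv_eq hab
  have hsymm := ha' u v
  rw [hda, fderiv_fun_smul hg.differentiableAt hb.differentiableAt] at hsymm
  simp only [add_apply, smul_apply, ContinuousLinearMap.smulRight_apply, smul_eq_mul] at hsymm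
  linear_combination hsymm - g z * hb' u v

theorem closedNear_inv_smul_fderiv {g : W → 𝕜} {p : W} (hg : AnalyticAt 𝕜 g p) (h0 : g p ≠ 0) :
    ClosedNear (fun z => (g z)⁻¹ • fderiv 𝕜 g z) p := by
  filter_upwards [hg.eventually_analyticAt, hg.continuousAt.eventually_ne h0] with z hg h0 u v
  have hsymm : IsSymmSndFDerivAt 𝕜 g z := hg.contDiffAt.isSymmSndFDerivAt (n := ω) le_top
  have hinv : fderiv 𝕜 (fun y => (g y)⁻¹) z = -((g z) ^ 2)⁻¹ • fderiv 𝕜 g z :=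
    ((hasDerivAt_inv h0).comp_hasFDerivAt z hg.differentiableAt.hasFDerivAt).fderiv
  rw [fderiv_fun_smul (hg.fun_inv h0).differentiableAt hg.fderiv.differentiableAt, hinv]
  simp only [add_apply, smul_apply, ContinuousLinearMap.smulRight_apply, smul_eq_mul, hsymm u v]
  ring

variable [Fintype ι] {a b : ι → W → W →L[𝕜] 𝕜} {g : ι → W → 𝕜} {p : W}

theorem HasNoAnalyticRelation.eventually_fderiv_eq_zero (hrel : HasNoAnalyticRelation b p)
    (hb : ∀ i, AnalyticAt 𝕜 (b i) p) (hb0 : ∀ i, b i p ≠ 0) (hbc : ∀ i, ClosedNear (b i) p)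
    (hg : ∀ i, AnalyticAt 𝕜 (g i) p) (hprod : ∀ᶠ z in 𝓝 p, ∏ i, g i z = 1)
    (hpar : ∀ i, ∀ᶠ z in 𝓝 p, Parallel (fderiv 𝕜 (g i) z) (b i z)) (i : ι) :
    ∀ᶠ z in 𝓝 p, fderiv 𝕜 (g i) z = 0 := by
  have hne : ∀ i, ∀ᶠ z in 𝓝 p, g i z ≠ 0 := fun i => hprod.mono fun z hz =>
    Finset.prod_ne_zero_iff.mp (hz ▸ one_ne_zero) i (Finset.mem_univ i)
  have hlog : ∀ i, AnalyticAt 𝕜 (fun z => (g i z)⁻¹ • fderiv 𝕜 (g i) z) p := fun i =>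
    ((hg i).inv (hne i).self_of_nhds).smul (hg i).fderiv
  choose f hf hfb using fun i => exists_analyticAt_smul_of_parallel (hlog i) (hb i) (hb0 i)
    ((hpar i).mono fun z hz => hz.smul_left _)
  have hf0 := hrel f hf ?_ fun i => eventually_parallel_fderiv_of_eq_smul (hf i) (hb i) (hfb i)
    (closedNear_inv_smul_fderiv (hg i) (hne i).self_of_nhds) (hbc i)
  · filter_upwards [hf0 i, hfb i, hne i] with z hfz hz hgz
    rw [hfz, zero_smul 𝕜 (b i z)] at hz
    exact (smul_eq_zero_iff_right (inv_ne_zero hgz)).mp hz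
  · filter_upwards [Filter.eventually_all.mpr hfb, eventually_eventually_nhds.mpr hprod,
      Filter.eventually_all.mpr fun i => (hg i).eventually_analyticAt] with z hfb hprod hg
    simp only [← hfb]
    exact sum_inv_smul_fderiv_eq_zero (fun i => (hg i).differentiableAt) hprod

theorem HasNoAnalyticRelation.eventually_eq_const_smul [IsRCLikeNormedField 𝕜]
    (hrel : HasNoAnalyticRelation b p)
    (ha : ∀ i, AnalyticAt 𝕜 (a i) p) (hac : ∀ i, ClosedNear (a i) p)
    (hb : ∀ i, AnalyticAt 𝕜 (b i) p) (hbc : ∀ i, ClosedNear (b i) p) (hb0 : ∀ i, b i p ≠ 0)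
    (hprod : ∀ᶠ z in 𝓝 p, ∀ v, ∏ i, a i z v = ∏ i, b i z v)
    (hpar : ∀ i, ∀ᶠ z in 𝓝 p, Parallel (a i z) (b i z)) (i : ι) :
    ∃ c : 𝕜, ∀ᶠ z in 𝓝 p, a i z = c • b i z := by
  choose g hg hab using fun i => exists_analyticAt_smul_of_parallel (ha i) (hb i) (hb0 i) (hpar i)
  obtain ⟨v, hv⟩ := exists_forall_apply_ne_zero hb0
  have hbv : ∀ᶠ z in 𝓝 p, ∀ i, b i z v ≠ 0 := Filter.eventually_all.mpr fun i =>
    (((ContinuousLinearMap.apply 𝕜 𝕜 v).continuous.continuousAt).comp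
      (hb i).continuousAt).eventually_ne (hv i)
  have hgprod : ∀ᶠ z in 𝓝 p, ∏ i, g i z = 1 := by
    filter_upwards [hprod, Filter.eventually_all.mpr hab, hbv] with z hprod hab hbv
    have hz := hprod v
    simp only [hab, smul_apply, smul_eq_mul, Finset.prod_mul_distrib] at hz
    exact mul_eq_right₀ (Finset.prod_ne_zero_iff.mpr fun i _ => hbv i) |>.mp hz
  have hconst := eventually_eq_const_of_fderiv_eq_zero
    ((hg i).eventually_analyticAt.mono fun z hz => hz.differentiableAt)
    (hrel.eventually_fderiv_eq_zero hb hb0 hbc hg hgprod (fun i =>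
      eventually_parallel_fderiv_of_eq_smul (hg i) (hb i) (hab i) (hac i) (hbc i)) i)
  exact ⟨g i p, by filter_upwards [hab i, hconst] with z hz hgz using hgz ▸ hz⟩

theorem HasNoAnalyticRelation.not_eventually_parallel (hrel : HasNoAnalyticRelation b p)
    (hb : ∀ i, AnalyticAt 𝕜 (b i) p) (hbc : ∀ i, ClosedNear (b i) p) {i j : ι} (hij : i ≠ j)
    (hb0 : b j p ≠ 0) : ¬ ∀ᶠ z in 𝓝 p, Parallel (b i z) (b j z) := by
  classical
  intro hpar
  obtain ⟨g, hg, hab⟩ := exists_analyticAt_smul_of_parallel (hb i) (hb j) hb0 hpar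
  have hdg := eventually_parallel_fderiv_of_eq_smul hg (hb j) hab (hbc i) (hbc j)
  let f : ι → W → 𝕜 := Function.update (fun k _ => (Pi.single i (-1) : ι → 𝕜) k) j g
  have hfj : f j = g := Function.update_self ..
  have hf : ∀ k, k ≠ j → f k = fun _ => (Pi.single i (-1) : ι → 𝕜) k := fun k hk =>
    Function.update_of_ne hk ..
  have hzero := hrel f (fun k => ?_) ?_ (fun k => ?_) i
  · simpa [hf i hij] using hzero.self_of_nhds
  · rcases eq_or_ne k j with rfl | hk
    · exact hfj ▸ hg
    · exact hf k hk ▸ analyticAt_const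
  · filter_upwards [hab] with z hz
    rw [Fintype.sum_eq_add i j hij fun k hk => by
        rw [hf k hk.2, Pi.single_eq_of_ne hk.1, zero_smul 𝕜 (b k z)],
      hfj, hf i hij, Pi.single_eq_same, hz]
    ext u
    simp
  · rcases eq_or_ne k j with rfl | hk
    · exact hfj ▸ hdg
    · exact Filter.Eventually.of_forall fun z => by
        rw [hf k hk, fderiv_const_apply]; exact parallel_zero_left _

end ClosedForms

/-! ### Forms on a complex manifold -/

section Pullback

variable {n : ℕ} {X Y Z : Type*} [TopologicalSpace X] [ChartedSpace (Fin n → ℂ) X]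
  [TopologicalSpace Y] [ChartedSpace (Fin n → ℂ) Y] [TopologicalSpace Z]
  [ChartedSpace (Fin n → ℂ) Z]

/-- The pullback `f^* μ` of a 1-form, meaningful where `f` is differentiable. -/
noncomputable def OneForm.pullback (f : Y → X) (μ : OneForm n X) : OneForm n Y :=
  fun y => (μ (f y)).comp (mfderiv 𝓘(ℂ, Fin n → ℂ) 𝓘(ℂ, Fin n → ℂ) f y)

theorem OneForm.pullback_id (μ : OneForm n X) : μ.pullback id = μ := by
  funext x
  rw [OneForm.pullback, mfderiv_id]
  exact ContinuousLinearMap.comp_id _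

theorem OneForm.pullback_congr (μ : OneForm n X) {f g : Y → X} {y : Y} (hfg : f =ᶠ[𝓝 y] g) :
    μ.pullback f y = μ.pullback g y := by
  have hμ : ∀ a b : X, a = b → (μ a : (Fin n → ℂ) →L[ℂ] ℂ) = μ b := by
    rintro a _ rfl
    rfl
  exact congrArg₂ (fun (α : (Fin n → ℂ) →L[ℂ] ℂ) (β : (Fin n → ℂ) →L[ℂ] (Fin n → ℂ)) => α.comp β)
    (hμ _ _ hfg.eq_of_nhds) hfg.mfderiv_eq

theorem OneForm.pullback_comp (μ : OneForm n X) {f : Y → X} {g : Z → Y} {z : Z}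
    (hf : MDifferentiableAt 𝓘(ℂ, Fin n → ℂ) 𝓘(ℂ, Fin n → ℂ) f (g z))
    (hg : MDifferentiableAt 𝓘(ℂ, Fin n → ℂ) 𝓘(ℂ, Fin n → ℂ) g z) :
    μ.pullback (f ∘ g) z = (μ.pullback f).pullback g z := by
  unfold OneForm.pullback
  rw [mfderiv_comp z hf hg]
  rfl

theorem OneForm.coord_eq_pullback (μ : OneForm n X) (x : X) :
    μ.coord x = μ.pullback (chartAt (Fin n → ℂ) x).symm := rfl

end Pullback

section Coordinates

variable {n : ℕ} {X Y : Type*} [TopologicalSpace X] [ChartedSpace (Fin n → ℂ) X]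
  [TopologicalSpace Y] [ChartedSpace (Fin n → ℂ) Y]

theorem eventually_mem_chart_source (x : X) : ∀ᶠ y in 𝓝 x, y ∈ (chartAt (Fin n → ℂ) x).source :=
  (chartAt (Fin n → ℂ) x).open_source.mem_nhds (mem_chart_source _ x)

variable [IsManifold 𝓘(ℂ, Fin n → ℂ) ω X]

theorem mdifferentiable_chartAt (x : X) : (chartAt (Fin n → ℂ) x).MDifferentiable
    𝓘(ℂ, Fin n → ℂ) 𝓘(ℂ, Fin n → ℂ) :=
  have : IsManifold 𝓘(ℂ, Fin n → ℂ) 1 X := .of_le (n := ω) le_top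
  mdifferentiable_chart x

variable [IsManifold 𝓘(ℂ, Fin n → ℂ) ω Y]

theorem analyticAt_chart_comp_chart_symm {f : Y → X} {y : Y} {x : X} {z : Fin n → ℂ}
    (hz : z ∈ (chartAt (Fin n → ℂ) y).target)
    (hf : ContMDiffAt 𝓘(ℂ, Fin n → ℂ) 𝓘(ℂ, Fin n → ℂ) ω f ((chartAt (Fin n → ℂ) y).symm z))
    (hx : f ((chartAt (Fin n → ℂ) y).symm z) ∈ (chartAt (Fin n → ℂ) x).source) :
    AnalyticAt ℂ (chartAt (Fin n → ℂ) x ∘ f ∘ (chartAt (Fin n → ℂ) y).symm) z :=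
  have hsymm : ContMDiffAt 𝓘(ℂ, Fin n → ℂ) 𝓘(ℂ, Fin n → ℂ) ω (chartAt (Fin n → ℂ) y).symm z :=
    contMDiffOn_chart_symm.contMDiffAt ((chartAt (Fin n → ℂ) y).open_target.mem_nhds hz)
  have hchart : ContMDiffAt 𝓘(ℂ, Fin n → ℂ) 𝓘(ℂ, Fin n → ℂ) ω (chartAt (Fin n → ℂ) x) _ :=
    contMDiffOn_chart.contMDiffAt ((chartAt (Fin n → ℂ) x).open_source.mem_nhds hx)
  (contMDiffAt_iff_contDiffAt.mp (hchart.comp z (hf.comp z hsymm))).analyticAt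

theorem OneForm.coord_pullback (μ : OneForm n X) {f : Y → X} {y : Y} {x : X} {z : Fin n → ℂ}
    (hz : z ∈ (chartAt (Fin n → ℂ) y).target)
    (hf : ContMDiffAt 𝓘(ℂ, Fin n → ℂ) 𝓘(ℂ, Fin n → ℂ) ω f ((chartAt (Fin n → ℂ) y).symm z))
    (hx : f ((chartAt (Fin n → ℂ) y).symm z) ∈ (chartAt (Fin n → ℂ) x).source) :
    (μ.pullback f).coord y z =
      (μ.coord x ((chartAt (Fin n → ℂ) x ∘ f ∘ (chartAt (Fin n → ℂ) y).symm) z)).comp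
        (fderiv ℂ (chartAt (Fin n → ℂ) x ∘ f ∘ (chartAt (Fin n → ℂ) y).symm) z) := by
  set φ := chartAt (Fin n → ℂ) y
  set ψ := chartAt (Fin n → ℂ) x
  have hφ := (mdifferentiable_chartAt y).mdifferentiableAt_symm hz
  have hψ := (mdifferentiable_chartAt x).mdifferentiableAt_symm (ψ.map_source hx)
  have hτ := (analyticAt_chart_comp_chart_symm hz hf hx).differentiableAt.mdifferentiableAt
  have hfφ : f ∘ φ.symm =ᶠ[𝓝 z] ψ.symm ∘ (ψ ∘ f ∘ φ.symm) := by
    filter_upwards [(hf.continuousAt.comp (φ.symm.continuousAt hz)).eventually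
      (ψ.open_source.mem_nhds hx)] with z' hz' using (ψ.left_inv hz').symm
  rw [OneForm.coord_eq_pullback, ← OneForm.pullback_comp μ (hf.mdifferentiableAt (by simp)) hφ,
    OneForm.pullback_congr μ hfφ, ← mfderiv_eq_fderiv]
  exact OneForm.pullback_comp μ hψ hτ

theorem OneForm.coord_pullback_eventuallyEq (μ : OneForm n X) {f : Y → X} {y : Y} {x : X}
    {z : Fin n → ℂ} (hz : z ∈ (chartAt (Fin n → ℂ) y).target)
    (hf : ContMDiffAt 𝓘(ℂ, Fin n → ℂ) 𝓘(ℂ, Fin n → ℂ) ω f ((chartAt (Fin n → ℂ) y).symm z))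
    (hx : f ((chartAt (Fin n → ℂ) y).symm z) ∈ (chartAt (Fin n → ℂ) x).source) :
    (μ.pullback f).coord y =ᶠ[𝓝 z] fun z' =>
      (μ.coord x ((chartAt (Fin n → ℂ) x ∘ f ∘ (chartAt (Fin n → ℂ) y).symm) z')).comp
        (fderiv ℂ (chartAt (Fin n → ℂ) x ∘ f ∘ (chartAt (Fin n → ℂ) y).symm) z') := by
  have hφ := (chartAt (Fin n → ℂ) y).symm.continuousAt hz
  filter_upwards [(chartAt (Fin n → ℂ) y).open_target.mem_nhds hz,
    hφ.eventually ((contMDiffAt_iff_contMDiffAt_nhds (by simp)).mp hf),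
    (hf.continuousAt.comp hφ).eventually
      ((chartAt (Fin n → ℂ) x).open_source.mem_nhds hx)] with z' hz' hf' hx'
  exact μ.coord_pullback hz' hf' hx'

theorem OneForm.IsClosedHolomorphicAt.pullback {μ : OneForm n X} {f : Y → X} {y : Y}
    (hμ : μ.IsClosedHolomorphicAt (f y))
    (hf : ContMDiffAt 𝓘(ℂ, Fin n → ℂ) 𝓘(ℂ, Fin n → ℂ) ω f y) :
    (μ.pullback f).IsClosedHolomorphicAt y := by
  let φ := chartAt (Fin n → ℂ) y
  let ψ := chartAt (Fin n → ℂ) (f y)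
  let τ := ψ ∘ f ∘ φ.symm
  have hyt : φ y ∈ φ.target := mem_chart_target _ y
  have hinv : φ.symm (φ y) = y := φ.left_inv (mem_chart_source _ y)
  have hf' : ContMDiffAt 𝓘(ℂ, Fin n → ℂ) 𝓘(ℂ, Fin n → ℂ) ω f (φ.symm (φ y)) := hinv.symm ▸ hf
  have hsrc : f (φ.symm (φ y)) ∈ ψ.source := hinv.symm ▸ mem_chart_source _ (f y)
  have hτ : AnalyticAt ℂ τ (φ y) := analyticAt_chart_comp_chart_symm hyt hf' hsrc
  have hτy : τ (φ y) = ψ (f y) := congrArg (ψ ∘ f) hinv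
  have hcoord := μ.coord_pullback_eventuallyEq hyt hf' hsrc
  obtain ⟨hμ, hμc⟩ := hμ
  rw [OneForm.IsHolomorphicAt, ← hτy] at hμ
  rw [OneForm.IsClosedAt, ← hτy] at hμc
  constructor
  · exact (((ContinuousLinearMap.compL ℂ (Fin n → ℂ) (Fin n → ℂ) ℂ).analyticAt_bilinear _).comp₂
      (AnalyticAt.comp hμ hτ) hτ.fderiv).congr hcoord.symm
  · intro u v
    rw [hcoord.fderiv_eq]
    exact fderiv_pullback_symm hτ hμ.differentiableAt hμc u v

end Coordinates

section LocalForms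

variable {n m : ℕ} {X : Type*} [TopologicalSpace X] [ChartedSpace (Fin n → ℂ) X]
  [IsManifold 𝓘(ℂ, Fin n → ℂ) ω X] {μ ν : OneForm n X} {x y : X}

theorem closedNear_coord (h : ∀ᶠ y in 𝓝 x, μ.IsClosedHolomorphicAt y) :
    ClosedNear (μ.coord x) (chartAt (Fin n → ℂ) x x) := by
  let φ := chartAt (Fin n → ℂ) x
  have hφ : Filter.Tendsto φ.symm (𝓝 (φ x)) (𝓝 x) := φ.tendsto_symm (mem_chart_source _ x)
  filter_upwards [hφ.eventually h, φ.open_target.mem_nhds (mem_chart_target _ x)]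
    with z ⟨hol, hcl⟩ hz u v
  have hid : ContMDiffAt 𝓘(ℂ, Fin n → ℂ) 𝓘(ℂ, Fin n → ℂ) ω id (φ.symm z) := contMDiffAt_id
  have hsrc : id (φ.symm z) ∈ (chartAt (Fin n → ℂ) (φ.symm z)).source := mem_chart_source _ _
  have hcoord := μ.coord_pullback_eventuallyEq hz hid hsrc
  rw [OneForm.pullback_id] at hcoord
  rw [hcoord.fderiv_eq]
  exact fderiv_pullback_symm (analyticAt_chart_comp_chart_symm hz hid hsrc)
    hol.differentiableAt hcl u v

theorem exists_coord_eq_comp (hy : y ∈ (chartAt (Fin n → ℂ) x).source) :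
    ∃ A : (Fin n → ℂ) →L[ℂ] TangentSpace 𝓘(ℂ, Fin n → ℂ) y, Function.Surjective A ∧
      ∀ μ : OneForm n X, μ.coord x (chartAt (Fin n → ℂ) x y) = (μ y).comp A := by
  obtain ⟨z, hz, rfl⟩ : ∃ z ∈ (chartAt (Fin n → ℂ) x).target, (chartAt (Fin n → ℂ) x).symm z = y :=
    ⟨_, (chartAt (Fin n → ℂ) x).map_source hy, (chartAt (Fin n → ℂ) x).left_inv hy⟩
  rw [(chartAt (Fin n → ℂ) x).right_inv hz]
  exact ⟨_, (mdifferentiable_chartAt x).symm.mfderiv_surjective hz, fun μ => rfl⟩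

theorem coord_eq_smul_iff (hy : y ∈ (chartAt (Fin n → ℂ) x).source) (c : ℂ) :
    μ.coord x (chartAt (Fin n → ℂ) x y) = c • ν.coord x (chartAt (Fin n → ℂ) x y) ↔
      μ y = c • ν y := by
  obtain ⟨A, hA, hcoord⟩ := exists_coord_eq_comp hy
  rw [hcoord, hcoord, ContinuousLinearMap.ext_iff, ContinuousLinearMap.ext_iff]
  exact (hA.forall (p := fun v => μ y v = (c • ν y) v)).symm

theorem coord_eq_zero_iff (hy : y ∈ (chartAt (Fin n → ℂ) x).source) :
    μ.coord x (chartAt (Fin n → ℂ) x y) = 0 ↔ μ y = 0 := by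
  have h := coord_eq_smul_iff (μ := μ) (ν := μ) hy 0
  rwa [zero_smul ℂ (μ.coord x _), zero_smul ℂ (μ y)] at h

theorem parallel_coord_iff (hy : y ∈ (chartAt (Fin n → ℂ) x).source) :
    Parallel (μ.coord x (chartAt (Fin n → ℂ) x y)) (ν.coord x (chartAt (Fin n → ℂ) x y)) ↔
      Parallel (μ y) (ν y) := by
  obtain ⟨A, hA, hcoord⟩ := exists_coord_eq_comp hy
  rw [hcoord, hcoord]
  exact (hA.forall₂ (p := fun u v => μ y u * ν y v = μ y v * ν y u)).symm

theorem OneForm.IsHolomorphicAt.eventually_eq_zero_or_generically_ne_zero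
    (hμ : μ.IsHolomorphicAt x) :
    (∀ᶠ y in 𝓝 x, μ y = 0) ∨ ∀ᶠ y in generically x, μ y ≠ 0 := by
  have hsrc := eventually_mem_chart_source (n := n) x
  refine (SymDiff.eventually_eq_zero_or_generically_ne_zero hμ).imp (fun h => ?_) fun h => ?_
  · filter_upwards [((chartAt (Fin n → ℂ) x).continuousAt (mem_chart_source _ x)).eventually h,
      hsrc] with y hy hys using (coord_eq_zero_iff hys).mp hy
  · filter_upwards [(tendsto_generically _ (mem_chart_source _ x)).eventually h,
      generically_le_nhds x hsrc] with y hy hys using mt (coord_eq_zero_iff hys).mpr hy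

theorem OneForm.IsHolomorphicAt.eventually_parallel_or_generically_not_parallel
    (hμ : μ.IsHolomorphicAt x) (hν : ν.IsHolomorphicAt x) :
    (∀ᶠ y in 𝓝 x, Parallel (μ y) (ν y)) ∨ ∀ᶠ y in generically x, ¬ Parallel (μ y) (ν y) := by
  have hsrc := eventually_mem_chart_source (n := n) x
  refine (SymDiff.eventually_parallel_or_generically_not_parallel hμ hν).imp
    (fun h => ?_) fun h => ?_
  · filter_upwards [((chartAt (Fin n → ℂ) x).continuousAt (mem_chart_source _ x)).eventually h,
      hsrc] with y hy hys using (parallel_coord_iff hys).mp hy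
  · filter_upwards [(tendsto_generically _ (mem_chart_source _ x)).eventually h,
      generically_le_nhds x hsrc] with y hy hys using mt (parallel_coord_iff hys).mpr hy

theorem OneForm.IsHolomorphicAt.eventually_parallel_of_generically (hμ : μ.IsHolomorphicAt x)
    (hν : ν.IsHolomorphicAt x) (h : ∀ᶠ y in generically x, Parallel (μ y) (ν y)) :
    ∀ᶠ y in 𝓝 x, Parallel (μ y) (ν y) :=
  (hμ.eventually_parallel_or_generically_not_parallel hν).resolve_right fun h' =>
    (h.and h').exists.elim fun _ hy => hy.2 hy.1

theorem exists_perm_eventually_parallel {ι : Type*} [Finite ι] {α β : ι → OneForm n X}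
    (hα : ∀ i, (α i).IsHolomorphicAt x) (hβ : ∀ i, (β i).IsHolomorphicAt x)
    (h : ∀ᶠ y in generically x, ∃ τ : Equiv.Perm ι, ∀ i, Parallel (α (τ i) y) (β i y)) :
    ∃ τ : Equiv.Perm ι, ∀ i, ∀ᶠ y in 𝓝 x, Parallel (α (τ i) y) (β i y) := by
  by_contra hne
  simp only [not_exists, not_forall] at hne
  choose i hi using hne
  have hgen : ∀ᶠ y in generically x, ∀ τ, ¬ Parallel (α (τ (i τ)) y) (β (i τ) y) :=
    Filter.eventually_all.mpr fun τ => (hα _).eventually_parallel_or_generically_not_parallel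
      (hβ _) |>.resolve_left (hi τ)
  obtain ⟨y, ⟨τ, hτ⟩, hy⟩ := (h.and hgen).exists
  exact hy τ (hτ (i τ))

theorem OneForm.IsHolomorphicAt.eventually_forall_eq_smul_imp (hμ : μ.IsHolomorphicAt x)
    (hν : ν.IsHolomorphicAt x) :
    ∀ᶠ y in 𝓝 x, ∀ c : ℂ, (∀ᶠ z in 𝓝 y, μ z = c • ν z) → ∀ᶠ z in 𝓝 x, μ z = c • ν z := by
  let φ := chartAt (Fin n → ℂ) x
  have hsrc := eventually_mem_chart_source (n := n) x
  have hφ : ContinuousAt φ x := φ.continuousAt (mem_chart_source _ x)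
  filter_upwards [hφ.eventually (SymDiff.eventually_forall_eq_smul_imp hμ hν),
    hsrc] with y hy hys c hc
  have hc' : ∀ᶠ z in 𝓝 (φ y), μ.coord x z = c • ν.coord x z := by
    filter_upwards [(φ.tendsto_symm hys).eventually hc, φ.open_target.mem_nhds (φ.map_source hys)]
      with z hz hzt
    have := (coord_eq_smul_iff (φ.map_target hzt) c).mpr hz
    rwa [φ.right_inv hzt] at this
  filter_upwards [hφ.eventually (hy c hc'), hsrc] with z hz hzs
    using (coord_eq_smul_iff hzs c).mp hz

theorem IsHolomorphicAt.eventually_eq_zero_or_generically_ne_zero {f : X → ℂ}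
    (hf : IsHolomorphicAt n f x) :
    (∀ᶠ y in 𝓝 x, f y = 0) ∨ ∀ᶠ y in generically x, f y ≠ 0 := by
  let φ := chartAt (Fin n → ℂ) x
  have hxs : x ∈ φ.source := mem_chart_source _ x
  have hsymm : ContMDiffAt 𝓘(ℂ, Fin n → ℂ) 𝓘(ℂ, Fin n → ℂ) ω φ.symm (φ x) :=
    contMDiffOn_chart_symm.contMDiffAt (φ.open_target.mem_nhds (φ.map_source hxs))
  have hcoord : AnalyticAt ℂ (f ∘ φ.symm) (φ x) :=
    (contMDiffAt_iff_contDiffAt.mp (ContMDiffAt.comp (φ x) (by rwa [φ.left_inv hxs])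
      hsymm)).analyticAt
  have hinv : ∀ᶠ y in 𝓝 x, φ.symm (φ y) = y :=
    (eventually_mem_chart_source x).mono fun y hy => φ.left_inv hy
  refine (SymDiff.eventually_eq_zero_or_generically_ne_zero hcoord).imp (fun h => ?_) fun h => ?_
  · filter_upwards [(φ.continuousAt hxs).eventually h, hinv] with y hy hys
    exact hys ▸ hy
  · filter_upwards [(tendsto_generically φ hxs).eventually h, generically_le_nhds x hinv]
      with y hy hys
    exact hys ▸ hy

theorem coord_differential_comp_chart {f : (Fin n → ℂ) → ℂ}
    (hy : y ∈ (chartAt (Fin n → ℂ) x).source)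
    (hf : DifferentiableAt ℂ f (chartAt (Fin n → ℂ) x y)) :
    (differential n (f ∘ chartAt (Fin n → ℂ) x)).coord x (chartAt (Fin n → ℂ) x y) =
      fderiv ℂ f (chartAt (Fin n → ℂ) x y) := by
  set φ := chartAt (Fin n → ℂ) x
  have hinv : f ∘ φ ∘ φ.symm =ᶠ[𝓝 (φ y)] f := by
    filter_upwards [φ.open_target.mem_nhds (φ.map_source hy)] with z hz
    exact congrArg f (φ.right_inv hz)
  have hφ := (mdifferentiable_chartAt x).mdifferentiableAt_symm (φ.map_source hy)
  have hfφ : MDifferentiableAt 𝓘(ℂ, Fin n → ℂ) 𝓘(ℂ) (f ∘ φ) (φ.symm (φ y)) := by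
    rw [φ.left_inv hy]
    exact hf.mdifferentiableAt.comp y ((mdifferentiable_chartAt x).mdifferentiableAt hy)
  rw [← hinv.fderiv_eq, ← mfderiv_eq_fderiv]
  exact (mfderiv_comp (φ y) hfφ hφ).symm

end LocalForms

/-! ### Uniqueness of closed decompositions -/

section ClosedDecompositions

variable {n m : ℕ} {X : Type u} [TopologicalSpace X] [ChartedSpace (Fin n → ℂ) X]
  {w : TensorField n m X} {μ ν : Fin m → OneForm n X} {x : X}

theorem IsClosedDecompositionAt.eventually (hμ : IsClosedDecompositionAt w μ x) :
    ∀ᶠ y in 𝓝 x, IsClosedDecompositionAt w μ y := by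
  obtain ⟨U, hU, hx, hclosed, hprod⟩ := hμ
  filter_upwards [hU.mem_nhds hx] with y hy
  exact ⟨U, hU, hy, hclosed, hprod⟩

theorem IsClosedDecompositionAt.isClosedHolomorphicAt (hμ : IsClosedDecompositionAt w μ x)
    (i : Fin m) : (μ i).IsClosedHolomorphicAt x :=
  let ⟨_, _, hx, hclosed, _⟩ := hμ
  hclosed i x hx

theorem IsClosedDecompositionAt.isHolomorphicAt (hμ : IsClosedDecompositionAt w μ x) (i : Fin m) :
    (μ i).IsHolomorphicAt x :=
  (hμ.isClosedHolomorphicAt i).1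

theorem IsClosedDecompositionAt.eq_symProd (hμ : IsClosedDecompositionAt w μ x) :
    w x = symProd fun i => μ i x :=
  let ⟨_, _, hx, _, hprod⟩ := hμ
  hprod x hx

theorem IsClosedDecompositionAt.apply_diag (hμ : IsClosedDecompositionAt w μ x)
    (v : TangentSpace 𝓘(ℂ, Fin n → ℂ) x) : w x (fun _ => v) = ∏ i, μ i x v := by
  rw [hμ.eq_symProd, symProd_diag]

theorem IsClosedDecompositionAt.prod_eq_one_mul_prod (hμ : IsClosedDecompositionAt w μ x)
    (hν : IsClosedDecompositionAt w ν x) (v : TangentSpace 𝓘(ℂ, Fin n → ℂ) x) :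
    ∏ i, μ i x v = 1 * ∏ i, ν i x v := by
  rw [one_mul, ← hμ.apply_diag, hν.apply_diag]

theorem IsClosedDecompositionAt.comp_perm (hμ : IsClosedDecompositionAt w μ x)
    (σ : Equiv.Perm (Fin m)) : IsClosedDecompositionAt w (fun i => μ (σ i)) x := by
  obtain ⟨U, hU, hx, hclosed, hprod⟩ := hμ
  refine ⟨U, hU, hx, fun i => hclosed (σ i), fun y hy => ?_⟩
  rw [hprod y hy, symProd_comp_perm fun i => μ i y]

/-- The factors of the decompositions `μ` and `ν` agree near `x` up to nonzero constants. -/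
def SameUpToConst (μ ν : Fin m → OneForm n X) (x : X) : Prop :=
  ∀ i, ∃ c : ℂ, c ≠ 0 ∧ ∀ᶠ y in 𝓝 x, μ i y = c • ν i y

theorem SameUpToConst.refl (μ : Fin m → OneForm n X) (x : X) : SameUpToConst μ μ x := fun i =>
  ⟨1, one_ne_zero, .of_forall fun y => (one_smul ℂ (μ i y)).symm⟩

theorem SameUpToConst.symm (h : SameUpToConst μ ν x) : SameUpToConst ν μ x := fun i =>
  let ⟨c, hc, hi⟩ := h i
  ⟨c⁻¹, inv_ne_zero hc, hi.mono fun y hy => by rw [hy, inv_smul_smul₀ hc]⟩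

theorem SameUpToConst.trans {κ : Fin m → OneForm n X} (h : SameUpToConst μ ν x)
    (h' : SameUpToConst ν κ x) : SameUpToConst μ κ x := fun i => by
  obtain ⟨c, hc, hi⟩ := h i
  obtain ⟨d, hd, hi'⟩ := h' i
  refine ⟨c * d, mul_ne_zero hc hd, ?_⟩
  filter_upwards [hi, hi'] with y hy hy'
  rw [hy, hy', smul_smul]

theorem SameUpToConst.comp_perm (h : SameUpToConst μ ν x) (σ : Equiv.Perm (Fin m)) :
    SameUpToConst (fun i => μ (σ i)) (fun i => ν (σ i)) x := fun i => h (σ i)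

theorem SameUpToConst.eventually (h : SameUpToConst μ ν x) :
    ∀ᶠ y in 𝓝 x, SameUpToConst μ ν y :=
  Filter.eventually_all.mpr fun i =>
    let ⟨c, hc, hi⟩ := h i
    (eventually_eventually_nhds.mpr hi).mono fun _ hy => ⟨c, hc, hy⟩

theorem SameUpToConst.parallel (h : SameUpToConst μ ν x) (i : Fin m) :
    ∀ᶠ y in 𝓝 x, Parallel (μ i y) (ν i y) := by
  obtain ⟨c, -, hi⟩ := h i
  filter_upwards [hi] with y hy
  exact hy ▸ (Parallel.refl _).smul_left c

theorem eventually_sameUpToConst_imp [IsManifold 𝓘(ℂ, Fin n → ℂ) ω X]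
    (hμ : ∀ i, (μ i).IsHolomorphicAt x) (hν : ∀ i, (ν i).IsHolomorphicAt x) :
    ∀ᶠ y in 𝓝 x, SameUpToConst μ ν y → SameUpToConst μ ν x := by
  filter_upwards [Filter.eventually_all.mpr fun i =>
    (hμ i).eventually_forall_eq_smul_imp (hν i)] with y hy h i
  obtain ⟨c, hc, hi⟩ := h i
  exact ⟨c, hc, hy i c hi⟩

end ClosedDecompositions

section Rigidity

variable {n m : ℕ} {X : Type u} [TopologicalSpace X] [ChartedSpace (Fin n → ℂ) X]
  {w : TensorField n m X} {μ ν κ : Fin m → OneForm n X} {x : X}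

/-- `κ` is a closed decomposition of `w` at `x` without nonzero holomorphic abelian relations. -/
def IsRigidDecompositionAt (w : TensorField n m X) (κ : Fin m → OneForm n X) (x : X) : Prop :=
  IsClosedDecompositionAt w κ x ∧
    HasNoAnalyticRelation (fun i => (κ i).coord x) (chartAt (Fin n → ℂ) x x)

/-- A weak form of triviality of the abelian rank: the points at which `w` has a decomposition
without holomorphic abelian relations are dense. -/
def HasDenselyTrivialAbelianRank (w : TensorField n m X) : Prop :=
  Dense {x | ∃ κ, IsRigidDecompositionAt w κ x}

variable [IsManifold 𝓘(ℂ, Fin n → ℂ) ω X]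

theorem IsRigidDecompositionAt.generically_ne_zero (hκ : IsRigidDecompositionAt w κ x) :
    ∀ᶠ y in generically x, ∀ i, κ i y ≠ 0 := by
  refine Filter.eventually_all.mpr fun i =>
    (hκ.1.isHolomorphicAt i).eventually_eq_zero_or_generically_ne_zero.resolve_left fun hzero => ?_
  let φ := chartAt (Fin n → ℂ) x
  refine hκ.2.not_eventually_eq_zero i ?_
  filter_upwards [(φ.tendsto_symm (mem_chart_source _ x)).eventually hzero,
    φ.open_target.mem_nhds (mem_chart_target _ x)] with z hz hzt
  exact φ.right_inv hzt ▸ (coord_eq_zero_iff (φ.map_target hzt)).mpr hz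

theorem eventually_parallel_coord {α β : OneForm n X} (h : ∀ᶠ y in 𝓝 x, Parallel (α y) (β y)) :
    ∀ᶠ z in 𝓝 (chartAt (Fin n → ℂ) x x), Parallel (α.coord x z) (β.coord x z) := by
  let φ := chartAt (Fin n → ℂ) x
  filter_upwards [(φ.tendsto_symm (mem_chart_source _ x)).eventually h,
    φ.open_target.mem_nhds (mem_chart_target _ x)] with z hz hzt
  exact φ.right_inv hzt ▸ (parallel_coord_iff (φ.map_target hzt)).mpr hz

theorem IsRigidDecompositionAt.generically_not_parallel (hκ : IsRigidDecompositionAt w κ x)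
    (hκ0 : ∀ i, κ i x ≠ 0) {i j : Fin m} (hij : i ≠ j) :
    ∀ᶠ y in generically x, ¬ Parallel (κ i y) (κ j y) :=
  (hκ.1.isHolomorphicAt i).eventually_parallel_or_generically_not_parallel
    (hκ.1.isHolomorphicAt j) |>.resolve_left fun hpar =>
      hκ.2.not_eventually_parallel hκ.1.isHolomorphicAt
        (fun k => closedNear_coord (hκ.1.eventually.mono fun _ hy => hy.isClosedHolomorphicAt k))
        hij (mt (coord_eq_zero_iff (mem_chart_source _ x)).mp (hκ0 j))
        (eventually_parallel_coord hpar)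

theorem IsRigidDecompositionAt.sameUpToConst (hκ : IsRigidDecompositionAt w κ x)
    (hκ0 : ∀ i, κ i x ≠ 0) (hμ : IsClosedDecompositionAt w μ x)
    (hpar : ∀ i, ∀ᶠ y in 𝓝 x, Parallel (μ i y) (κ i y)) : SameUpToConst μ κ x := fun i => by
  let φ := chartAt (Fin n → ℂ) x
  have hprod : ∀ᶠ z in 𝓝 (φ x), ∀ v, ∏ i, (μ i).coord x z v = ∏ i, (κ i).coord x z v := by
    filter_upwards [(φ.tendsto_symm (mem_chart_source _ x)).eventually
      (hμ.eventually.and hκ.1.eventually)] with z hz v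
    exact (hz.1.apply_diag _).symm.trans (hz.2.apply_diag _)
  obtain ⟨c, hc⟩ := hκ.2.eventually_eq_const_smul hμ.isHolomorphicAt
    (fun k => closedNear_coord (hμ.eventually.mono fun _ hy => hy.isClosedHolomorphicAt k))
    hκ.1.isHolomorphicAt
    (fun k => closedNear_coord (hκ.1.eventually.mono fun _ hy => hy.isClosedHolomorphicAt k))
    (fun k => mt (coord_eq_zero_iff (mem_chart_source _ x)).mp (hκ0 k)) hprod
    (fun k => eventually_parallel_coord (hpar k)) i
  have heq : ∀ᶠ y in 𝓝 x, μ i y = c • κ i y := by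
    filter_upwards [(φ.continuousAt (mem_chart_source _ x)).eventually hc,
      eventually_mem_chart_source (n := n) x] with y hy hys using (coord_eq_smul_iff hys c).mp hy
  have hμ0 := (ne_zero_of_prod_eq (hκ.1.prod_eq_one_mul_prod hμ) hκ0).2 i
  refine ⟨c, fun hc0 => hμ0 ?_, heq⟩
  rw [heq.self_of_nhds, hc0, zero_smul ℂ (κ i x)]

theorem HasDenselyTrivialAbelianRank.generically_ne_zero (hw : HasDenselyTrivialAbelianRank w)
    (hμ : IsClosedDecompositionAt w μ x) : ∀ᶠ y in generically x, ∀ i, μ i y ≠ 0 := by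
  refine Filter.eventually_all.mpr fun i =>
    (hμ.isHolomorphicAt i).eventually_eq_zero_or_generically_ne_zero.resolve_left fun hzero => ?_
  obtain ⟨y, ⟨κ, hκ⟩, hy⟩ := exists_mem_of_eventually_generically hw
    (generically_le_nhds x (eventually_eventually_nhds.mpr (hzero.and hμ.eventually)))
  obtain ⟨z, ⟨⟨hμz, hμ⟩, hκz⟩, hκ0⟩ := ((generically_le_nhds y (hy.and hκ.1.eventually)).and
    hκ.generically_ne_zero).exists
  exact (ne_zero_of_prod_eq (hκz.prod_eq_one_mul_prod hμ) hκ0).2 i hμz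

theorem HasDenselyTrivialAbelianRank.generically_not_parallel
    (hw : HasDenselyTrivialAbelianRank w) (hμ : IsClosedDecompositionAt w μ x) :
    ∀ᶠ y in generically x, ∀ i j, i ≠ j → ¬ Parallel (μ i y) (μ j y) := by
  simp only [Filter.eventually_all]
  intro i j hij
  refine (hμ.isHolomorphicAt i).eventually_parallel_or_generically_not_parallel
    (hμ.isHolomorphicAt j) |>.resolve_left fun hpar => ?_
  obtain ⟨y, ⟨κ, hκ⟩, hμ0, hy⟩ := exists_mem_of_eventually_generically hw
    ((hw.generically_ne_zero hμ).and (generically_le_nhds x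
      (eventually_eventually_nhds.mpr (hpar.and hμ.eventually))))
  have hκ0 := (ne_zero_of_prod_eq (hy.self_of_nhds.2.prod_eq_one_mul_prod hκ.1) hμ0).2
  have hκpar : ∀ᶠ z in generically y, ∀ a b, a ≠ b → ¬ Parallel (κ a z) (κ b z) := by
    simp only [Filter.eventually_all]
    exact fun a b hab => hκ.generically_not_parallel hκ0 hab
  obtain ⟨z, ⟨⟨hμz, hμ⟩, hκz⟩, hκz0, hκpar⟩ := ((generically_le_nhds y
    (hy.and hκ.1.eventually)).and (hκ.generically_ne_zero.and hκpar)).exists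
  exact pairwise_not_parallel_of_prod_eq (hκz.prod_eq_one_mul_prod hμ) hκz0 hκpar i j hij hμz

theorem HasDenselyTrivialAbelianRank.exists_perm_parallel (hw : HasDenselyTrivialAbelianRank w)
    (hμ : IsClosedDecompositionAt w μ x) {α : Fin m → OneForm n X}
    (hα : ∀ i, (α i).IsHolomorphicAt x)
    (h : ∀ᶠ y in generically x, ∃ c : ℂ, ∀ v, w y (fun _ => v) = c * ∏ i, α i y v) :
    ∃ σ : Equiv.Perm (Fin m), ∀ i, ∀ᶠ y in 𝓝 x, Parallel (μ (σ i) y) (α i y) := by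
  refine exists_perm_eventually_parallel hμ.isHolomorphicAt hα ?_
  filter_upwards [generically_le_nhds x hμ.eventually, hw.generically_ne_zero hμ,
    hw.generically_not_parallel hμ, h] with y hμ hμ0 hpar ⟨c, hc⟩
  exact exists_perm_parallel_of_prod_eq (fun v => (hμ.apply_diag v).symm.trans (hc v)) hμ0 hpar

theorem HasDenselyTrivialAbelianRank.exists_perm_parallel_of_decomposition
    (hw : HasDenselyTrivialAbelianRank w) (hμ : IsClosedDecompositionAt w μ x)
    (hν : IsClosedDecompositionAt w ν x) :
    ∃ σ : Equiv.Perm (Fin m), ∀ i, ∀ᶠ y in 𝓝 x, Parallel (μ (σ i) y) (ν i y) :=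
  hw.exists_perm_parallel hμ hν.isHolomorphicAt <|
    generically_le_nhds x <| hν.eventually.mono fun _ hy =>
      ⟨1, fun v => (hy.apply_diag v).trans (one_mul _).symm⟩

theorem HasDenselyTrivialAbelianRank.sameUpToConst (hw : HasDenselyTrivialAbelianRank w)
    (hμ : IsClosedDecompositionAt w μ x) (hν : IsClosedDecompositionAt w ν x)
    (hpar : ∀ i, ∀ᶠ y in 𝓝 x, Parallel (μ i y) (ν i y)) : SameUpToConst μ ν x := by
  obtain ⟨y, ⟨κ, hκ⟩, hν0, ⟨hμ, hν⟩, hpar, himp⟩ := exists_mem_of_eventually_generically hw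
    ((hw.generically_ne_zero hν).and (generically_le_nhds x
      ((hμ.eventually.and hν.eventually).and
        ((eventually_eventually_nhds.mpr (Filter.eventually_all.mpr hpar)).and
          (eventually_sameUpToConst_imp hμ.isHolomorphicAt hν.isHolomorphicAt)))))
  have hκ0 := (ne_zero_of_prod_eq (hν.prod_eq_one_mul_prod hκ.1) hν0).2
  obtain ⟨τ, hτ⟩ := hw.exists_perm_parallel_of_decomposition hν hκ.1
  have hνκ : SameUpToConst (fun i => ν (τ i)) κ y := hκ.sameUpToConst hκ0 (hν.comp_perm τ) hτ
  have hμκ : SameUpToConst (fun i => μ (τ i)) κ y :=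
    hκ.sameUpToConst hκ0 (hμ.comp_perm τ) fun i => by
      obtain ⟨c, -, hc⟩ := hνκ.symm i
      filter_upwards [hc, hpar] with z hz hpar
      exact hz ▸ ((hpar (τ i)).symm.smul_left c).symm
  have hμν := (hμκ.trans hνκ.symm).comp_perm τ.symm
  simp only [Equiv.apply_symm_apply] at hμν
  exact himp hμν

theorem HasDenselyTrivialAbelianRank.exists_perm (hw : HasDenselyTrivialAbelianRank w)
    (hμ : IsClosedDecompositionAt w μ x) (hν : IsClosedDecompositionAt w ν x) :
    ∃ σ : Equiv.Perm (Fin m), SameUpToConst μ (fun i => ν (σ i)) x := by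
  obtain ⟨σ, hσ⟩ := hw.exists_perm_parallel_of_decomposition hν hμ
  exact ⟨σ, (hw.sameUpToConst (hν.comp_perm σ) hμ hσ).symm⟩

theorem HasDenselyTrivialAbelianRank.perm_eq (hw : HasDenselyTrivialAbelianRank w)
    (hμ : IsClosedDecompositionAt w μ x) {σ τ : Equiv.Perm (Fin m)}
    (h : SameUpToConst (fun i => μ (σ i)) (fun i => μ (τ i)) x) : σ = τ := by
  ext1 i
  by_contra hne
  obtain ⟨y, hpar, hnpar⟩ := ((generically_le_nhds x (h.parallel i)).and
    (hw.generically_not_parallel hμ)).exists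
  exact hnpar _ _ hne hpar

theorem HasDenselyTrivialAbelianRank.prod_eq_one (hw : HasDenselyTrivialAbelianRank w)
    (hμ : IsClosedDecompositionAt w μ x) (hν : IsClosedDecompositionAt w ν x) {c : Fin m → ℂ}
    (h : ∀ i, ∀ᶠ y in 𝓝 x, μ i y = c i • ν i y) : ∏ i, c i = 1 := by
  obtain ⟨y, ⟨h, hμ, hν⟩, hν0⟩ := ((generically_le_nhds x ((Filter.eventually_all.mpr h).and
    (hμ.eventually.and hν.eventually))).and (hw.generically_ne_zero hν)).exists
  obtain ⟨v, hv⟩ := exists_forall_apply_ne_zero hν0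
  have hprod := hμ.prod_eq_one_mul_prod hν v
  simp only [h, smul_apply, smul_eq_mul, Finset.prod_mul_distrib] at hprod
  exact mul_right_cancel₀ (Finset.prod_ne_zero_iff.mpr fun i _ => hv i) hprod

theorem HasDenselyTrivialAbelianRank.const_eq (hw : HasDenselyTrivialAbelianRank w)
    (hν : IsClosedDecompositionAt w ν x) {i : Fin m} {α : OneForm n X} {c d : ℂ}
    (hc : ∀ᶠ y in 𝓝 x, α y = c • ν i y) (hd : ∀ᶠ y in 𝓝 x, α y = d • ν i y) : c = d := by
  obtain ⟨y, ⟨hc, hd⟩, hν0⟩ := ((generically_le_nhds x (hc.and hd)).and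
    (hw.generically_ne_zero hν)).exists
  exact smul_left_injective ℂ (hν0 i) (hc.symm.trans hd)

end Rigidity

section AbelianRank

variable {n m : ℕ} {X : Type u} [TopologicalSpace X] [ChartedSpace (Fin n → ℂ) X]
  [IsManifold 𝓘(ℂ, Fin n → ℂ) ω X] {w : TensorField n m X} {μ : Fin m → OneForm n X} {x : X}

theorem HasOnlyTrivialAbelianRelations.hasNoAnalyticRelation
    (h : HasOnlyTrivialAbelianRelations μ x) :
    HasNoAnalyticRelation (fun i => (μ i).coord x) (chartAt (Fin n → ℂ) x x) := by
  intro f hf hsum hpar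
  let φ := chartAt (Fin n → ℂ) x
  have hxs : x ∈ φ.source := mem_chart_source _ x
  have hφ : Filter.Tendsto φ (𝓝 x) (𝓝 (φ x)) := φ.continuousAt hxs
  have hchart : ContMDiffAt 𝓘(ℂ, Fin n → ℂ) 𝓘(ℂ, Fin n → ℂ) ω φ x :=
    contMDiffOn_chart.contMDiffAt (φ.open_source.mem_nhds hxs)
  let F : Fin m → MeromorphicGerm n x := fun i =>
    { num := f i ∘ φ
      den := fun _ => 1
      num_holomorphic := (hf i).contDiffAt.contMDiffAt.comp x hchart
      den_holomorphic := contMDiffAt_const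
      den_ne_zero := .of_forall fun _ => one_ne_zero }
  have hval : ∀ i, (F i).val = f i ∘ φ := fun i => funext fun y => div_one _
  have hF : IsAbelianRelation μ F := by
    refine ⟨?_, fun i => ?_⟩
    · filter_upwards [eventually_mem_chart_source (n := n) x, hφ.eventually hsum] with y hy hs _
      obtain ⟨A, hA, hcoord⟩ := exists_coord_eq_comp hy
      ext v
      obtain ⟨u, rfl⟩ := hA v
      have hsu : ∑ i, f i (φ y) * (μ i).coord x (φ y) u = 0 := by
        simpa using DFunLike.congr_fun hs u
      simp only [φ, hcoord] at hsu
      rw [sum_apply]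
      simp only [hval]
      exact hsu
    · filter_upwards [eventually_mem_chart_source (n := n) x, hφ.eventually (hpar i),
        hφ.eventually (hf i).eventually_analyticAt] with y hy hp han _ u v
      rw [← coord_differential_comp_chart hy han.differentiableAt, parallel_coord_iff hy] at hp
      rw [hval]
      exact sub_eq_zero.mpr (hp u v)
  intro i
  filter_upwards [(φ.tendsto_symm hxs).eventually (h F hF i),
    φ.open_target.mem_nhds (mem_chart_target _ x)] with z hz hzt
  exact φ.right_inv hzt ▸ hz

theorem HasTrivialAbelianRank.hasDenselyTrivialAbelianRank (hw : HasTrivialAbelianRank w) :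
    HasDenselyTrivialAbelianRank w := by
  obtain ⟨R, -, hint, h⟩ := hw
  refine (interior_eq_empty_iff_dense_compl.mp hint).mono fun x hx => ?_
  obtain ⟨κ, hκ, hrel⟩ := h x hx
  exact ⟨κ, hκ, hrel.hasNoAnalyticRelation⟩

end AbelianRank

/-! ### Global orderings of the factors -/

section Labelling

variable {n m : ℕ} {X Y : Type u} [TopologicalSpace X] [ChartedSpace (Fin n → ℂ) X]
  [TopologicalSpace Y] [ChartedSpace (Fin n → ℂ) Y] {w : TensorField n m X} {f : Y → X}

theorem TensorField.pullback_id (w : TensorField n m X) : w.pullback id = w := by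
  funext x
  rw [TensorField.pullback, mfderiv_id]
  rfl

theorem TensorField.pullback_eq_symProd {μ : Fin m → OneForm n X} {y : Y}
    (h : w (f y) = symProd fun i => μ i (f y)) :
    w.pullback f y = symProd fun i => (μ i).pullback f y := by
  rw [TensorField.pullback, h]
  ext v
  simp only [symProd, ContinuousMultilinearMap.compContinuousLinearMap_apply, smul_apply,
    sum_apply]
  rfl

variable [IsManifold 𝓘(ℂ, Fin n → ℂ) ω X] [IsManifold 𝓘(ℂ, Fin n → ℂ) ω Y]

theorem HasDenselyTrivialAbelianRank.hasTwistedClosedDecomposition_pullback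
    (hw : HasDenselyTrivialAbelianRank w)
    (hf : ContMDiff 𝓘(ℂ, Fin n → ℂ) 𝓘(ℂ, Fin n → ℂ) ω f)
    (Λ : Y → Fin m → OneForm n X) (hΛ : ∀ y, IsClosedDecompositionAt w (Λ y) (f y))
    (hloc : ∀ y, ∀ᶠ z in 𝓝 y, SameUpToConst (Λ y) (Λ z) (f z)) :
    HasTwistedClosedDecomposition (w.pullback f) := by
  let U : Y → Set Y := fun a =>
    interior {y | SameUpToConst (Λ a) (Λ y) (f y) ∧ IsClosedDecompositionAt w (Λ a) (f y)}
  have hcover : IsOpenCover U := ⟨fun _ => isOpen_interior, fun y =>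
    ⟨y, mem_interior_iff_mem_nhds.mpr
      ((hloc y).and (hf.continuous.continuousAt.eventually (hΛ y).eventually))⟩⟩
  have hdec : ∀ a, ∀ y ∈ U a, IsClosedDecompositionAt w (Λ a) (f y) := fun a y hy =>
    (interior_subset hy).2
  have hsame : ∀ a b, ∀ y ∈ U a ∩ U b, SameUpToConst (Λ a) (Λ b) (f y) := fun a b y hy =>
    (interior_subset hy.1).1.trans (interior_subset hy.2).1.symm
  choose! g hg0 hg using hsame
  have hg_const : ∀ k a b, ∀ y ∈ U a ∩ U b, IsLocallyConstantAt (fun y => g a b y k) y := by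
    intro k a b y hy
    filter_upwards [((hcover.1 a).inter (hcover.1 b)).mem_nhds hy,
      hf.continuous.continuousAt.eventually (eventually_eventually_nhds.mpr (hg a b y hy k))]
      with z hz hyz
    exact hw.const_eq (hdec b z hz.2) (hg a b z hz k) hyz
  have hg_cocycle : ∀ k a b c, ∀ y ∈ U a ∩ U b ∩ U c, g a b y k * g b c y k = g a c y k := by
    intro k a b c y hy
    refine hw.const_eq (hdec c y hy.2) (α := Λ a k) ?_ (hg a c y ⟨hy.1.1, hy.2⟩ k)
    filter_upwards [hg a b y hy.1 k, hg b c y ⟨hy.1.2, hy.2⟩ k] with z hab hbc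
    rw [hab, mul_smul, ← hbc]
  refine ⟨Y, U, hcover, fun k => ⟨fun a b y => g a b y k, fun a b y hy => hg0 a b y hy k,
    hg_const k, hg_cocycle k⟩, fun k a => (Λ a k).pullback f, fun _ _ => 1,
    fun k => ⟨fun a y hy => ((hdec a y hy).isClosedHolomorphicAt k).pullback (hf y), ?_⟩,
    ⟨fun _ _ _ => ⟨one_ne_zero, .of_forall fun _ => rfl⟩, fun a b y hy => ?_⟩, fun a y hy => ?_⟩
  · intro a b y hy
    ext v
    exact DFunLike.congr_fun (hg a b y hy k).self_of_nhds _
  · rw [hw.prod_eq_one (hdec a y hy.1) (hdec b y hy.2) (hg a b y hy), one_mul]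
  · rw [one_smul]
    exact TensorField.pullback_eq_symProd (hdec a y hy).eq_symProd

theorem HasDenselyTrivialAbelianRank.hasTwistedClosedDecomposition
    (hw : HasDenselyTrivialAbelianRank w) (Λ : X → Fin m → OneForm n X)
    (hΛ : ∀ x, IsClosedDecompositionAt w (Λ x) x)
    (hloc : ∀ x, ∀ᶠ y in 𝓝 x, SameUpToConst (Λ x) (Λ y) y) :
    HasTwistedClosedDecomposition w := by
  rw [← TensorField.pullback_id w]
  exact hw.hasTwistedClosedDecomposition_pullback contMDiff_id Λ hΛ hloc

end Labelling

section Split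

variable {n m : ℕ} {X : Type u} [TopologicalSpace X] [ChartedSpace (Fin n → ℂ) X]
  [IsManifold 𝓘(ℂ, Fin n → ℂ) ω X] {w : TensorField n m X}

theorem HasDenselyTrivialAbelianRank.exists_generically_parallel
    (hw : HasDenselyTrivialAbelianRank w) (hfirst : IsFirstKind w) {ψ α : Fin m → OneForm n X}
    {x : X} (hα : ∀ i, (α i).IsHolomorphicAt x)
    (h : ∀ᶠ y in generically x, ∃ (c : ℂ) (b : Fin m → ℂ),
      (∀ v, w y (fun _ => v) = c * ∏ i, α i y v) ∧ ∀ i, α i y = b i • ψ i y) :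
    ∃ μ : Fin m → OneForm n X, IsClosedDecompositionAt w μ x ∧
      ∀ᶠ y in generically x, ∀ i, ψ i y ≠ 0 ∧ Parallel (μ i y) (ψ i y) := by
  obtain ⟨ν, hν⟩ := hfirst x
  obtain ⟨σ, hσ⟩ := hw.exists_perm_parallel hν hα (h.mono fun y ⟨c, _, hc, _⟩ => ⟨c, hc⟩)
  refine ⟨fun i => ν (σ i), hν.comp_perm σ, ?_⟩
  filter_upwards [h, generically_le_nhds x (Filter.eventually_all.mpr hσ),
    generically_le_nhds x hν.eventually, hw.generically_ne_zero hν]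
    with y ⟨c, b, hc, hb⟩ hσ hν hν0 i
  have hα0 := (ne_zero_of_prod_eq (fun v => (hν.apply_diag v).symm.trans (hc v)) hν0).2 i
  refine ⟨fun hψ0 => hα0 ?_, (hσ i).trans ?_ hα0⟩
  · rw [hb, hψ0]
    exact smul_zero (A := TangentSpace 𝓘(ℂ, Fin n → ℂ) y →L[ℂ] ℂ) (b i)
  · exact hb i ▸ (Parallel.refl _).smul_left (b i)

theorem HasDenselyTrivialAbelianRank.hasTwistedClosedDecomposition_of_label
    (hw : HasDenselyTrivialAbelianRank w) (hfirst : IsFirstKind w) (ψ : Fin m → OneForm n X)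
    (hψ : ∀ x, ∃ α : Fin m → OneForm n X, (∀ i, (α i).IsHolomorphicAt x) ∧
      ∀ᶠ y in generically x, ∃ (c : ℂ) (b : Fin m → ℂ),
        (∀ v, w y (fun _ => v) = c * ∏ i, α i y v) ∧ ∀ i, α i y = b i • ψ i y) :
    HasTwistedClosedDecomposition w := by
  have hlabel : ∀ x, ∃ μ : Fin m → OneForm n X, IsClosedDecompositionAt w μ x ∧
      ∀ᶠ y in generically x, ∀ i, ψ i y ≠ 0 ∧ Parallel (μ i y) (ψ i y) := fun x =>
    let ⟨_, hα, h⟩ := hψ x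
    hw.exists_generically_parallel hfirst hα h
  choose Λ hΛ hΛψ using hlabel
  refine hw.hasTwistedClosedDecomposition Λ hΛ fun x => ?_
  filter_upwards [(hΛ x).eventually, eventually_eventually_generically (hΛψ x)] with y hxy hψy
  refine hw.sameUpToConst hxy (hΛ y) fun i =>
    (hxy.isHolomorphicAt i).eventually_parallel_of_generically ((hΛ y).isHolomorphicAt i) ?_
  filter_upwards [hψy, hΛψ y] with z hx hy
  exact (hx i).2.trans (hy i).2.symm (hx i).1

theorem HasDenselyTrivialAbelianRank.hasTwistedClosedDecomposition_of_isMeromorphicallySplit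
    (hw : HasDenselyTrivialAbelianRank w) (hfirst : IsFirstKind w)
    (h : IsMeromorphicallySplit w) : HasTwistedClosedDecomposition w := by
  obtain ⟨ψ, hψ, D, hD, hdense, hprod⟩ := h
  refine hw.hasTwistedClosedDecomposition_of_label hfirst ψ fun x => ?_
  choose α b hα hb hb0 hψα using fun k => hψ k x
  have hbg : ∀ k, ∀ᶠ y in generically x, b k y ≠ 0 := fun k =>
    (hb k).eventually_eq_zero_or_generically_ne_zero.resolve_left fun hzero =>
      hb0 k (hzero.mono fun y hy => not_not.mpr hy)
  refine ⟨α, hα, ?_⟩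
  filter_upwards [Filter.eventually_all.mpr hbg,
    eventually_generically_mem_of_dense hD hdense x,
    generically_le_nhds x (Filter.eventually_all.mpr hψα)] with y hb0 hyD hψα
  refine ⟨∏ k, (b k y)⁻¹, fun k => b k y, fun v => ?_, fun k => ?_⟩
  · rw [hprod y hyD, symProd_diag, ← Finset.prod_mul_distrib]
    refine Finset.prod_congr rfl fun k _ => ?_
    rw [hψα k (hb0 k)]
    rfl
  · rw [hψα k (hb0 k), smul_inv_smul₀ (hb0 k) (α k y)]

theorem HasDenselyTrivialAbelianRank.hasTwistedClosedDecomposition_of_isLineBundleSplit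
    (hw : HasDenselyTrivialAbelianRank w) (hfirst : IsFirstKind w) (h : IsLineBundleSplit w) :
    HasTwistedClosedDecomposition w := by
  obtain ⟨ι, U, ⟨hU, hcover⟩, L, μ, t, hμ, -, hprod⟩ := h
  choose a ha using hcover
  refine hw.hasTwistedClosedDecomposition_of_label hfirst (fun k y => μ k (a y) y) fun x =>
    ⟨fun k => μ k (a x), fun k => (hμ k).1 _ x (ha x), ?_⟩
  filter_upwards [generically_le_nhds x ((hU (a x)).mem_nhds (ha x))] with y hy
  refine ⟨t (a x) y, fun k => (L k).g (a x) (a y) y, fun v => ?_,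
    fun k => (hμ k).2 _ _ y ⟨hy, ha y⟩⟩
  rw [hprod _ y hy, smul_apply, symProd_diag, smul_eq_mul]

end Split

/-! ### Finite coverings -/

section Covering

variable {E X : Type*} {f : E → X}

theorem finite_preimage_domRestrict {s : Set X} (h : (f ⁻¹' s).Finite) (C : Set E) :
    (C.domRestrict f ⁻¹' s).Finite :=
  Set.Finite.preimage (f := ((↑) : C → E)) Subtype.val_injective.injOn h

variable [TopologicalSpace E] [TopologicalSpace X]

theorem isClosedMap_of_isCoveringMap (hf : IsCoveringMap f) (hfin : ∀ x, (f ⁻¹' {x}).Finite) :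
    IsClosedMap f := by
  choose _ U hxU hU _ H hH using hf
  have hcover : TopologicalSpace.IsOpenCover fun x => (⟨U x, hU x⟩ : TopologicalSpace.Opens X) :=
    .mk <| eq_top_iff.mpr fun x _ => TopologicalSpace.Opens.mem_iSup.mpr ⟨x, hxU x⟩
  refine hcover.isClosedMap_iff_restrictPreimage.mpr fun x => ?_
  have : Finite (f ⁻¹' {x}) := hfin x
  have hfst : (U x).restrictPreimage f = Prod.fst ∘ H x :=
    funext fun e => Subtype.ext (hH x e).symm
  exact hfst ▸ isClosedMap_fst_of_compactSpace.comp (H x).isClosedMap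

theorem secondCountableTopology_of_isCoveringMap [SecondCountableTopology X]
    (hf : IsCoveringMap f) (hfin : ∀ x, (f ⁻¹' {x}).Finite) : SecondCountableTopology E := by
  choose _ U hxU hU hfU H _ using hf
  obtain ⟨s, hs, hcover⟩ := TopologicalSpace.countable_cover_nhds fun x => (hU x).mem_nhds (hxU x)
  have : Countable s := hs
  have (x : s) : SecondCountableTopology (f ⁻¹' U x) := by
    have : Finite (f ⁻¹' {x.1}) := hfin x
    exact (H x).secondCountableTopology
  refine TopologicalSpace.secondCountableTopology_of_countable_cover
    (fun x : s => hfU x) (Set.eq_univ_of_forall fun e => ?_)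
  obtain ⟨x, hx, hex⟩ := Set.mem_iUnion₂.mp (hcover.symm ▸ Set.mem_univ (f e))
  exact Set.mem_iUnion.mpr ⟨⟨x, hx⟩, hex⟩

theorem t2Space_of_isCoveringMap [T2Space X] (hf : IsCoveringMap f) : T2Space E := by
  refine ⟨fun a b hab => ?_⟩
  by_cases h : f a = f b
  · exact hf.isSeparatedMap a b h hab
  · exact separated_by_continuous hf.continuous h

theorem isCoveringMap_domRestrict_of_isClopen [T2Space E] (hf : IsCoveringMap f)
    (hfin : ∀ x, (f ⁻¹' {x}).Finite) {C : Set E} (hC : IsClopen C) :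
    IsCoveringMap (C.domRestrict f) := by
  have hclosed : IsClosedMap (C.domRestrict f) :=
    (isClosedMap_of_isCoveringMap hf hfin).comp hC.1.isClosedMap_subtype_val
  have hlocal : IsLocalHomeomorph (C.domRestrict f) :=
    hf.isLocalHomeomorph.comp hC.2.isOpenEmbedding_subtypeVal.isLocalHomeomorph
  exact isCoveringMap_iff_isCoveringMapOn_univ.mpr <|
    hclosed.isCoveringMapOn_of_isLocalHomeomorphOn
      (fun x _ => finite_preimage_domRestrict (hfin x) C) hlocal.isLocalHomeomorphOn

theorem exists_isClopen_surjective_connectedSpace [LocallyConnectedSpace E]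
    (hf : IsCoveringMap f) (hfin : ∀ x, (f ⁻¹' {x}).Finite) (hsurj : Function.Surjective f) :
    ∃ C : Set E, IsClopen C ∧ Function.Surjective (C.domRestrict f) ∧
      (ConnectedSpace X → ConnectedSpace C) := by
  by_cases hX : ConnectedSpace X
  · obtain ⟨e, -⟩ := hsurj hX.toNonempty.some
    have hC : IsClopen (connectedComponent e) :=
      ⟨isClosed_connectedComponent, isOpen_connectedComponent⟩
    have himage : IsClopen (f '' connectedComponent e) :=
      ⟨isClosedMap_of_isCoveringMap hf hfin _ hC.1, hf.isOpenMap _ hC.2⟩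
    refine ⟨connectedComponent e, hC, ?_, fun _ =>
      isConnected_iff_connectedSpace.mp isConnected_connectedComponent⟩
    rw [← Set.range_eq_univ, Set.range_domRestrict]
    exact himage.eq_univ ⟨f e, e, mem_connectedComponent, rfl⟩
  · refine ⟨Set.univ, isClopen_univ, ?_, fun h => absurd h hX⟩
    rw [← Set.range_eq_univ, Set.range_domRestrict, Set.image_univ, hsurj.range_eq]

end Covering

section Manifold

variable {H E X : Type*} [TopologicalSpace H] [TopologicalSpace E] [TopologicalSpace X]
  [ChartedSpace H X] {f : E → X}

/-- The charts of the base `X`, lifted to `E` along local inverses of the local homeomorphism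
`f : E → X`. -/
noncomputable abbrev liftChartedSpace (H : Type*) [TopologicalSpace H] [ChartedSpace H X]
    (hf : IsLocalHomeomorph f) : ChartedSpace H E where
  atlas := Set.range fun e => (hf e).choose ≫ₕ chartAt H (f e)
  chartAt e := (hf e).choose ≫ₕ chartAt H (f e)
  mem_chart_source e := by
    obtain ⟨he, hfe⟩ := (hf e).choose_spec
    refine ⟨he, show (hf e).choose e ∈ (chartAt H (f e)).source from ?_⟩
    rw [← congrFun hfe e]
    exact mem_chart_source H (f e)
  chart_mem_atlas e := ⟨e, rfl⟩

theorem hasGroupoid_liftChartedSpace (G : StructureGroupoid H) [ClosedUnderRestriction G]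
    [HasGroupoid X G] (hf : IsLocalHomeomorph f) :
    letI := liftChartedSpace H hf
    HasGroupoid E G := by
  let := liftChartedSpace H hf
  refine ⟨?_⟩
  rintro _ _ ⟨a, rfl⟩ ⟨b, rfl⟩
  obtain ⟨-, hφ⟩ := (hf a).choose_spec
  obtain ⟨-, hψ⟩ := (hf b).choose_spec
  set φ := (hf a).choose
  set ψ := (hf b).choose
  let c := chartAt H (f a)
  let d := chartAt H (f b)
  let T := (φ ≫ₕ c).symm ≫ₕ (ψ ≫ₕ d)
  have hψφ : ∀ z ∈ T.source, ψ (φ.symm (c.symm z)) = c.symm z := fun z hz => by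
    have hzφ : c.symm z ∈ φ.target := hz.1.2
    rw [← congrFun hψ, congrFun hφ, φ.right_inv hzφ]
  have hsource : T.source ⊆ (c.symm ≫ₕ d).source := fun z hz =>
    ⟨hz.1.1, show c.symm z ∈ d.source from hψφ z hz ▸ hz.2.2⟩
  have hmem := G.restr_mem_of_eqOn (G.compatible (chart_mem_atlas H (f a))
    (chart_mem_atlas H (f b))) T.open_source (e' := T)
    (fun z hz => congrArg d (hψφ z hz).symm) (Set.inter_subset_left.trans hsource)
  rwa [T.restr_eq_of_source_subset subset_rfl] at hmem

variable {𝕜 V : Type*} [NontriviallyNormedField 𝕜] [NormedAddCommGroup V] [NormedSpace 𝕜 V]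
  {I : ModelWithCorners 𝕜 V H} {k : WithTop ℕ∞} [IsManifold I k X]

theorem isManifold_liftChartedSpace (hf : IsLocalHomeomorph f) :
    letI := liftChartedSpace H hf
    IsManifold I k E :=
  let := liftChartedSpace H hf
  have := hasGroupoid_liftChartedSpace (contDiffGroupoid k I) hf
  IsManifold.mk' I k E

theorem isLocalDiffeomorph_liftChartedSpace (hf : IsLocalHomeomorph f) :
    letI := liftChartedSpace H hf
    IsLocalDiffeomorph I I k f := by
  let := liftChartedSpace H hf
  have := isManifold_liftChartedSpace (I := I) (k := k) hf
  intro e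
  obtain ⟨-, hφ⟩ := (hf e).choose_spec
  let c := chartAt H (f e)
  let T := chartAt H e ≫ₕ c.symm
  refine ⟨⟨T.toPartialEquiv, T.open_source, T.open_target, ?_, ?_⟩,
    ⟨mem_chart_source H e, c.mapsTo (mem_chart_source H e).2⟩, fun y hy => ?_⟩
  · exact contMDiffOn_chart_symm.comp' contMDiffOn_chart
  · exact contMDiffOn_chart_symm.comp' contMDiffOn_chart
  · have hy : f y ∈ c.source := congrFun hφ y ▸ hy.1.2
    exact (c.left_inv hy).symm.trans (congrArg _ (congrArg c (congrFun hφ y)))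

end Manifold

/-! ### The covering of orderings -/

section Monodromy

/-- The orderings of the `m` factors of a decomposition. This copy of `Equiv.Perm (Fin m)` carries
the discrete topology, since it is the fibre of a covering. -/
@[ext]
structure Ordering (m : ℕ) where
  perm : Equiv.Perm (Fin m)

instance (m : ℕ) : TopologicalSpace (Ordering m) := ⊥

instance (m : ℕ) : DiscreteTopology (Ordering m) := ⟨rfl⟩

instance (m : ℕ) : Finite (Ordering m) :=
  Finite.of_injective Ordering.perm fun _ _ => Ordering.ext

variable {n m : ℕ} {X : Type u} [TopologicalSpace X] [ChartedSpace (Fin n → ℂ) X]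
  {w : TensorField n m X} {μ ν : Fin m → OneForm n X} {x : X}

open Classical in
/-- The permutation that matches the factors of `μ` near `x` with those of `ν` up to constants;
the junk value is `1` when there is no such permutation. -/
noncomputable def matching (μ ν : Fin m → OneForm n X) (x : X) : Equiv.Perm (Fin m) :=
  if h : ∃ σ : Equiv.Perm (Fin m), SameUpToConst μ (fun i => ν (σ i)) x then h.choose else 1

variable [IsManifold 𝓘(ℂ, Fin n → ℂ) ω X]

theorem HasDenselyTrivialAbelianRank.sameUpToConst_matching (hw : HasDenselyTrivialAbelianRank w)
    (hμ : IsClosedDecompositionAt w μ x) (hν : IsClosedDecompositionAt w ν x) :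
    SameUpToConst μ (fun i => ν (matching μ ν x i)) x := by
  rw [matching, dif_pos (hw.exists_perm hμ hν)]
  exact (hw.exists_perm hμ hν).choose_spec

theorem HasDenselyTrivialAbelianRank.matching_eq (hw : HasDenselyTrivialAbelianRank w)
    (hμ : IsClosedDecompositionAt w μ x) (hν : IsClosedDecompositionAt w ν x)
    {σ : Equiv.Perm (Fin m)} (h : SameUpToConst μ (fun i => ν (σ i)) x) : matching μ ν x = σ :=
  hw.perm_eq hν ((hw.sameUpToConst_matching hμ hν).symm.trans h)

theorem HasDenselyTrivialAbelianRank.matching_self (hw : HasDenselyTrivialAbelianRank w)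
    (hμ : IsClosedDecompositionAt w μ x) : matching μ μ x = 1 :=
  hw.matching_eq hμ hμ (SameUpToConst.refl μ x)

theorem HasDenselyTrivialAbelianRank.matching_mul_matching (hw : HasDenselyTrivialAbelianRank w)
    {κ : Fin m → OneForm n X} (hμ : IsClosedDecompositionAt w μ x)
    (hν : IsClosedDecompositionAt w ν x) (hκ : IsClosedDecompositionAt w κ x) :
    matching ν κ x * matching μ ν x = matching μ κ x := by
  have hμκ := (hw.sameUpToConst_matching hμ hν).trans
    ((hw.sameUpToConst_matching hν hκ).comp_perm (matching μ ν x))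
  exact (hw.matching_eq hμ hκ (σ := matching ν κ x * matching μ ν x) hμκ).symm

theorem HasDenselyTrivialAbelianRank.eventually_matching_eq (hw : HasDenselyTrivialAbelianRank w)
    (hμ : IsClosedDecompositionAt w μ x) (hν : IsClosedDecompositionAt w ν x) :
    ∀ᶠ y in 𝓝 x, matching μ ν y = matching μ ν x := by
  filter_upwards [(hw.sameUpToConst_matching hμ hν).eventually, hμ.eventually, hν.eventually]
    with y hσ hμ hν
  exact hw.matching_eq hμ hν hσ

/-- The covering of `X` whose fibre at `x` consists of the orderings of the factors of `w` near
`x`, given as a bundle with discrete fibres: for chosen closed decompositions `μ a` of `w` at `a`,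
an ordering `τ` in the coordinates of `a` stands for the factors `i ↦ μ a (τ i)`. -/
noncomputable def orderingBundle (hw : HasDenselyTrivialAbelianRank w)
    (μ : X → Fin m → OneForm n X) (hμ : ∀ x, IsClosedDecompositionAt w (μ x) x) :
    FiberBundleCore X X (Ordering m) where
  baseSet a := {y | IsClosedDecompositionAt w (μ a) y}
  isOpen_baseSet _ := isOpen_iff_mem_nhds.mpr fun _ hy => hy.eventually
  indexAt x := x
  mem_baseSet_at := hμ
  coordChange a b y τ := ⟨matching (μ a) (μ b) y * τ.perm⟩
  coordChange_self a y hy τ := by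
    rw [hw.matching_self hy, one_mul]
  continuousOn_coordChange a b := by
    rintro ⟨y, τ⟩ ⟨⟨ha, hb⟩, -⟩
    have hτ : ∀ᶠ σ in 𝓝 τ, σ = τ := mem_nhds_discrete.mpr rfl
    refine ContinuousAt.continuousWithinAt (tendsto_nhds_of_eventually_eq ?_)
    rw [nhds_prod_eq]
    filter_upwards [(hw.eventually_matching_eq ha hb).prod_mk hτ] with p hp
    rw [hp.1, hp.2]
  coordChange_comp a b c y hy τ := by
    rw [← mul_assoc, hw.matching_mul_matching hy.1.1 hy.1.2 hy.2]

theorem eventually_localTrivAt_snd_eq {ι B F : Type*} [TopologicalSpace B] [TopologicalSpace F]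
    [DiscreteTopology F] (Z : FiberBundleCore ι B F) (b : B) (v : F) :
    ∀ᶠ p in 𝓝 (⟨b, v⟩ : Z.TotalSpace), (Z.localTrivAt b p).2 = v := by
  have hcont : ContinuousAt (fun p => (Z.localTrivAt b p).2) (⟨b, v⟩ : Z.TotalSpace) :=
    continuous_snd.continuousAt.comp
      ((Z.localTrivAt b).continuousAt (Z.mk_mem_localTrivAt_source b v))
  filter_upwards [hcont.eventually (mem_nhds_discrete.mpr rfl : ∀ᶠ u in 𝓝 _, u = _)] with p hp
  exact hp.trans (congrArg Prod.snd (Z.localTrivAt_apply_mk b v))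

theorem HasDenselyTrivialAbelianRank.exists_labelled_covering
    (hw : HasDenselyTrivialAbelianRank w) (hfirst : IsFirstKind w) :
    ∃ (E : Type u) (_ : TopologicalSpace E) (f : E → X), IsCoveringMap f ∧
      Function.Surjective f ∧ (∀ x, (f ⁻¹' {x}).Finite) ∧
      ∃ Λ : E → Fin m → OneForm n X, (∀ e, IsClosedDecompositionAt w (Λ e) (f e)) ∧
        ∀ e, ∀ᶠ e' in 𝓝 e, SameUpToConst (Λ e) (Λ e') (f e') := by
  choose μ hμ using hfirst
  let Z := orderingBundle hw μ hμ
  refine ⟨Z.TotalSpace, inferInstance, Z.proj, FiberBundle.isCoveringMap,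
    fun x => ⟨⟨x, (⟨1⟩ : Ordering m)⟩, rfl⟩, fun x => ?_,
    fun e i => μ e.1 (Ordering.perm e.2 i), fun e => (hμ e.1).comp_perm _, ?_⟩
  · refine (Set.finite_range fun τ : Ordering m => (⟨x, τ⟩ : Z.TotalSpace)).subset ?_
    rintro ⟨y, τ⟩ rfl
    exact ⟨τ, rfl⟩
  · rintro ⟨x, τ⟩
    filter_upwards [eventually_localTrivAt_snd_eq Z x τ,
      Z.continuous_proj.continuousAt.eventually (hμ x).eventually] with ⟨y, τ'⟩ hτ hxy
    have hτ : (⟨matching (μ y) (μ x) y * Ordering.perm τ'⟩ : Ordering m) = τ := hτ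
    rw [← hτ]
    exact ((hw.sameUpToConst_matching (hμ y) hxy).comp_perm (Ordering.perm τ')).symm

end Monodromy

end SymDiff

theorem corollary1p2_general {n m : ℕ} {X : Type u} [TopologicalSpace X] [T2Space X]
    [SecondCountableTopology X] [ChartedSpace (Fin n → ℂ) X] [IsManifold 𝓘(ℂ, Fin n → ℂ) ω X]
    (w : SymDiff.TensorField n m X) (hfirst : SymDiff.IsFirstKind w)
    (hrank : SymDiff.HasDenselyTrivialAbelianRank w) :
    (∃ (X' : Type u) (_ : TopologicalSpace X') (_ : ChartedSpace (Fin n → ℂ) X') (f : X' → X),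
        T2Space X' ∧ SecondCountableTopology X' ∧ IsManifold 𝓘(ℂ, Fin n → ℂ) ω X' ∧
        (ConnectedSpace X → ConnectedSpace X') ∧
        SymDiff.IsFiniteUnramifiedCover n f ∧
        SymDiff.HasTwistedClosedDecomposition (SymDiff.TensorField.pullback f w)) ∧
      (SymDiff.IsSplit w → SymDiff.HasTwistedClosedDecomposition w) := by
  refine ⟨?_, fun h => h.elim
    (hrank.hasTwistedClosedDecomposition_of_isMeromorphicallySplit hfirst)
    (hrank.hasTwistedClosedDecomposition_of_isLineBundleSplit hfirst)⟩
  obtain ⟨E, _, f, hf, hsurj, hfin, Λ, hΛ, hloc⟩ := hrank.exists_labelled_covering hfirst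
  have : T2Space E := SymDiff.t2Space_of_isCoveringMap hf
  have : LocallyConnectedSpace E :=
    let := SymDiff.liftChartedSpace (Fin n → ℂ) hf.isLocalHomeomorph
    ChartedSpace.locallyConnectedSpace (Fin n → ℂ) E
  obtain ⟨C, hC, hCsurj, hCconn⟩ := SymDiff.exists_isClopen_surjective_connectedSpace hf hfin hsurj
  have hCf := SymDiff.isCoveringMap_domRestrict_of_isClopen hf hfin hC
  have hCfin : ∀ x, (C.domRestrict f ⁻¹' {x}).Finite := fun x =>
    SymDiff.finite_preimage_domRestrict (hfin x) C
  let := SymDiff.liftChartedSpace (Fin n → ℂ) hCf.isLocalHomeomorph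
  have hCman : IsManifold 𝓘(ℂ, Fin n → ℂ) ω C :=
    SymDiff.isManifold_liftChartedSpace hCf.isLocalHomeomorph
  have hCdiff : IsLocalDiffeomorph 𝓘(ℂ, Fin n → ℂ) 𝓘(ℂ, Fin n → ℂ) ω (C.domRestrict f) :=
    SymDiff.isLocalDiffeomorph_liftChartedSpace hCf.isLocalHomeomorph
  exact ⟨C, inferInstance, inferInstance, C.domRestrict f, inferInstance,
    SymDiff.secondCountableTopology_of_isCoveringMap hCf hCfin, hCman, hCconn,
    ⟨hCf, hCsurj, hCfin, hCdiff⟩,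
    hrank.hasTwistedClosedDecomposition_pullback hCdiff.contMDiff (fun e => Λ e)
      (fun e => hΛ e) fun e => continuous_subtype_val.continuousAt.eventually (hloc e)⟩

theorem corollary1p2 {n m : ℕ} {X : Type u} [TopologicalSpace X] [T2Space X]
    [SecondCountableTopology X] [ChartedSpace (Fin n → ℂ) X]
    [IsManifold 𝓘(ℂ, Fin n → ℂ) ω X]
    (w : SymDiff.TensorField n m X) (hw : SymDiff.IsSymmetricDifferential w)
    (hfirst : SymDiff.IsFirstKind w) (hrank : SymDiff.HasTrivialAbelianRank w) :
    (∃ (X' : Type u) (_ : TopologicalSpace X') (_ : ChartedSpace (Fin n → ℂ) X') (f : X' → X),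
        T2Space X' ∧ SecondCountableTopology X' ∧ IsManifold 𝓘(ℂ, Fin n → ℂ) ω X' ∧
        (ConnectedSpace X → ConnectedSpace X') ∧
        SymDiff.IsFiniteUnramifiedCover n f ∧
        SymDiff.HasTwistedClosedDecomposition (SymDiff.TensorField.pullback f w)) ∧
      (SymDiff.IsSplit w → SymDiff.HasTwistedClosedDecomposition w) :=
  corollary1p2_general w hfirst hrank.hasDenselyTrivialAbelianRank
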